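/- **Hurwitz numbers.** For $g\ge 0$, $n\ge 1$ and $b_1,\dots,b_n\ge 1$ put $d=b_1+\cdots+b_n$ and $m=2g-1+n$. Let $h_{g,b_1,\dots,b_n}$ be the Hurwitz number that counts, with weight $1/|\mathrm{Aut}|$, the degree $d$ ramified coverings of the sphere by genus $g$ surfaces that are totally ramified over $0$, have $n$ labelled preimages of $\infty$ with multiplicities $b_1,\dots,b_n$, and have exactly one simple ramification over each of $m$ fixed further points. In terms of monodromy, $h_{g,b_1,\dots,b_n}$ is $1/d!$ times the number of tuples $(\sigma,\tau_1,\dots,\tau_m,\rho)$ in the symmetric group $S_d$ with $\sigma\tau_1\cdots\tau_m\rho=1$, where $\sigma$ is a $d$-cycle, each $\tau_k$ is a transposition, and the cycles of $\rho$ are labelled by $1,\dots,n$ so that the $i$-th one has length $b_i$. **Goulden–Jackson–Vakil numbers.** These are numbers $\langle\lambda_{2j}\tau_{d_1}\cdots\tau_{d_n}\rangle\in\mathbb{Q}$, symmetric in $d_1,\dots,d_n$, which vanish unless $4g-3+n=2j+d_1+\cdots+d_n$ for some $g\ge j$, and for which $$\frac{h_{g,b_1,\dots,b_n}}{d\cdot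 m!}=\sum_{j=0}^{g}(-1)^j\sum_{d_1+\cdots+d_n=4g-3+n-2j}\langle\lambda_{2j}\tau_{d_1}\cdots\tau_{d_n}\rangle\,b_1^{d_1}\cdots b_n^{d_n}$$ for all $g\ge0$, $n\ge1$ with $(g,n)\ne(0,1),(0,2)$ and all $b_1,\dots,b_n\ge1$. Write $\langle\tau_{d_1}\cdots\tau_{d_n}\rangle$ for the numbers with $j=0$ (the $\lambda$-free ones), and let $$F(q_1,q_2,\dots)=\sum_{k_0,k_1,\dots}\langle\tau_0^{k_0}\tau_1^{k_1}\cdots\rangle\frac{(0!\,q_1)^{k_0}}{k_0!}\frac{(1!\,q_2)^{k_1}}{k_1!}\cdots\in\mathbb{Q}[[q_1,q_2,\dots]].$$ **Operators.** On $\mathbb{Q}[[q_1,q_2,\dots]]$ let $$\Lambda_1=\sum_{i\ge2}q_i\,(i-1)\frac{\partial}{\partial q_{i-1}},\qquad M_2=\frac12\sum_{\substack{i,j\ge1\\ i+j\ge3}}q_iq_j\,(i+j-2)\frac{\partial}{\partial q_{i+j-2}}+\frac12\sum_{i,j\ge1}q_{i+j+2}\,ij\frac{\partial^2}{\partial q_i\partial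 q_j}.$$ **Theorem.** The Goulden–Jackson–Vakil numbers exist and are unique. The series $\exp(M_2)q_1=\sum_{k\ge0}\frac{1}{k!}M_2^k q_1$ is a well-defined formal power series (only finitely many $k$ contribute to each coefficient). The series $F$ satisfies the string equation $$\frac{\partial F}{\partial q_1}=\Lambda_1F+\frac{q_1^2}{2}$$ and the explicit formula $$\frac{\partial^2F}{\partial q_1^2}=\exp(M_2)\,q_1 .$$ -/

import Mathlib

open scoped Nat

noncomputable section

namespace GJV

/-- The degree `d = b₁ + ⋯ + bₙ` of the covering. -/
def degree {n : ℕ} (b : Fin n → ℕ) : ℕ := ∑ i, b i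

/-- The number `m = 2g - 1 + n` of simple branch points (used for `n ≥ 1` only). -/
def numSimple (g n : ℕ) : ℕ := 2 * g + n - 1

/-- Monodromy data of a degree `d` covering of the sphere: `σ` (around `0`) is a cycle of length
`d`, `τ₁, …, τₘ` (around the fixed points `z₁, …, zₘ`) are transpositions, `ρ` (around `∞`)
satisfies `σ τ₁ ⋯ τₘ ρ = 1`, and the cycles of `ρ`, that is the preimages of `∞`, are labelled
by `1, …, n` through `c`, in such a way that the `i`-th one has length `b i`. -/
structure IsMonodromy {n d m : ℕ} (b : Fin n → ℕ)
    (σ : Equiv.Perm (Fin d)) (τ : Fin m → Equiv.Perm (Fin d)) (ρ : Equiv.Perm (Fin d))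
    (c : Fin d → Fin n) : Prop where
  full_cycle : ∀ x y, σ.SameCycle x y
  simple : ∀ k, (τ k).IsSwap
  prod_eq_one : σ * (List.ofFn τ).prod * ρ = 1
  label : ∀ x y, c x = c y ↔ ρ.SameCycle x y
  length : ∀ i, {x | c x = i}.ncard = b i

/-- The Hurwitz number `h_{g; b₁, …, bₙ}`: the number of degree `d` coverings of the sphere of
genus `g`, totally ramified over `0`, with labelled preimages of `∞` of multiplicities
`b₁, …, bₙ`, and with a simple ramification over each of `m = 2g - 1 + n` fixed points, every
covering counted with weight `1 / |Aut|`. This is the number of monodromy data divided by `d!`. -/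
def hurwitz (g : ℕ) {n : ℕ} (b : Fin n → ℕ) : ℚ :=
  ({x : Equiv.Perm (Fin (degree b)) × (Fin (numSimple g n) → Equiv.Perm (Fin (degree b))) ×
        Equiv.Perm (Fin (degree b)) × (Fin (degree b) → Fin n) |
      IsMonodromy b x.1 x.2.1 x.2.2.1 x.2.2.2}.ncard : ℚ) / ((degree b)! : ℚ)

/-- The exponent vector `(k₀, k₁, …)` for which `τ_{d₁} ⋯ τ_{dₙ} = τ₀^{k₀} τ₁^{k₁} ⋯`. -/
def expVec {n : ℕ} (d : Fin n → ℕ) : ℕ →₀ ℕ := ∑ i, Finsupp.single (d i) 1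

/-- `N j k` is a candidate for the number `⟨λ_{2j} τ₀^{k₀} τ₁^{k₁} ⋯⟩`. The system `N` consists of
the Goulden-Jackson-Vakil numbers if
* it obeys the dimension constraint `4g - 3 + n = 2j + d₁ + ⋯ + dₙ` for some genus `g ≥ j`
  (all other brackets vanish), and
* `h_{g;b} / (d · m!)` equals
  `∑_{j ≤ g} (-1)^j ∑_{d₁ + ⋯ + dₙ = 4g-3+n-2j} ⟨λ_{2j} τ_{d₁} ⋯ τ_{dₙ}⟩ b₁^{d₁} ⋯ bₙ^{dₙ}`
  for all `g ≥ 0`, `n ≥ 1` with `(g, n) ≠ (0, 1), (0, 2)`, and all `b₁, …, bₙ ≥ 1`. -/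
structure IsGJVSystem (N : ℕ → (ℕ →₀ ℕ) → ℚ) : Prop where
  dimension : ∀ (j : ℕ) (k : ℕ →₀ ℕ),
    (¬ ∃ g, j ≤ g ∧ 4 * g + k.sum (fun _ e => e) = 2 * j + k.sum (fun i e => i * e) + 3) →
      N j k = 0
  formula : ∀ (g n : ℕ), 1 ≤ n → (g = 0 → 3 ≤ n) → ∀ b : Fin n → ℕ, (∀ i, 1 ≤ b i) →
    hurwitz g b / ((degree b : ℚ) * ((numSimple g n)! : ℚ)) =
      ∑ j ∈ Finset.range (g + 1), (-1 : ℚ) ^ j *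
        ∑ d ∈ Finset.piAntidiag (Finset.univ : Finset (Fin n)) (4 * g + n - 3 - 2 * j),
          N j (expVec d) * ∏ i, (b i : ℚ) ^ d i

/-- The Goulden-Jackson-Vakil numbers `⟨λ_{2j} τ₀^{k₀} τ₁^{k₁} ⋯⟩`: the (unique) system of numbers
defined by the Hurwitz numbers through the Goulden-Jackson-Vakil formula. -/
def bracket : ℕ → (ℕ →₀ ℕ) → ℚ := Classical.epsilon IsGJVSystem

/-- Formal power series in the variables `q₁, q₂, …`. -/
abbrev Series : Type := MvPowerSeries ℕ+ ℚ

/-- The variable `q_i`. -/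
def q (i : ℕ+) : Series := MvPowerSeries.X i

/-- The partial derivative `∂/∂q_i`. -/
def del (i : ℕ+) (f : Series) : Series := MvPowerSeries.pderiv ℚ i f

/-- A family of series can be summed formally: only finitely many of its members contribute to
each coefficient. -/
def FormallySummable {ι : Type} (f : ι → Series) : Prop :=
  ∀ α : ℕ+ →₀ ℕ, {i | MvPowerSeries.coeff α (f i) ≠ 0}.Finite

/-- The formal (coefficientwise) sum of a family of series. -/
def formalSum {ι : Type} (f : ι → Series) : Series :=
  fun α => ∑ᶠ i, MvPowerSeries.coeff α (f i)

/-- The terms `q_i (i-1) ∂f/∂q_{i-1}` of `Λ₁ f`. The term `i = 1` is zero, because of its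
factor `i - 1`. -/
def Lambda1Term (f : Series) (i : ℕ+) : Series :=
  ((i : ℚ) - 1) • (q i * del (i - 1) f)

/-- `Λ₁ = ∑_{i ≥ 2} q_i (i-1) ∂/∂q_{i-1}`. -/
def Lambda1 (f : Series) : Series := formalSum (Lambda1Term f)

/-- The terms `q_i q_j (i+j-2) ∂f/∂q_{i+j-2}` of `M₂ f`. The term `i = j = 1` is zero, because of
its factor `i + j - 2`. -/
def joinTerm (f : Series) (p : ℕ+ × ℕ+) : Series :=
  ((p.1 : ℚ) + (p.2 : ℚ) - 2) • (q p.1 * q p.2 * del (p.1 + p.2 - 2) f)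

/-- The terms `q_{i+j+2} i j ∂²f/∂q_i∂q_j` of `M₂ f`. -/
def cutTerm (f : Series) (p : ℕ+ × ℕ+) : Series :=
  ((p.1 : ℚ) * (p.2 : ℚ)) • (q (p.1 + p.2 + 2) * del p.1 (del p.2 f))

/-- `M₂ = ½ ∑_{i,j ≥ 1} q_i q_j (i+j-2) ∂/∂q_{i+j-2} + ½ ∑_{i,j ≥ 1} q_{i+j+2} i j ∂²/∂q_i∂q_j`. -/
def M2 (f : Series) : Series :=
  (1 / 2 : ℚ) • formalSum (joinTerm f) + (1 / 2 : ℚ) • formalSum (cutTerm f)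

/-- The terms `Dᵏ f / k!` of `exp(D) f`. -/
def expTerm (D : Series → Series) (f : Series) (k : ℕ) : Series :=
  ((k ! : ℚ)⁻¹) • (D^[k] f)

/-- `exp(D) f = ∑_k Dᵏ f / k!`. -/
def expOp (D : Series → Series) (f : Series) : Series := formalSum (expTerm D f)

/-- The generating function
`F = ∑_{k₀,k₁,…} ⟨τ₀^{k₀} τ₁^{k₁} ⋯⟩ (0! q₁)^{k₀} / k₀! · (1! q₂)^{k₁} / k₁! ⋯`, given by its
coefficients: that of `∏_i q_i^{α_i}` has `k_{i-1} = α_i`. -/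
def F : Series := fun α =>
  bracket 0 (α.mapDomain PNat.natPred) *
    α.prod (fun i e => (((i.natPred)! : ℚ) ^ e) / (e ! : ℚ))

lemma coeff_q_mul_ne_zero {i : ℕ+} {f : Series} {α : ℕ+ →₀ ℕ}
    (h : MvPowerSeries.coeff α (q i * f) ≠ 0) : i ∈ α.support := by
  by_contra hi
  have hd : (MvPowerSeries.X i : MvPowerSeries ℕ+ ℚ) ∣ q i * f := Dvd.intro _ rfl
  exact h (MvPowerSeries.X_dvd_iff.1 hd α (by simpa using hi))

/-- The sum that defines `Λ₁ f` is a legitimate formal sum, for every `f`. -/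
theorem summable_Lambda1Term (f : Series) : FormallySummable (Lambda1Term f) := by
  intro α
  refine α.support.finite_toSet.subset fun i hi => ?_
  simp only [Lambda1Term, Set.mem_ofPred_eq, map_smul, smul_eq_mul] at hi
  exact coeff_q_mul_ne_zero (right_ne_zero_of_mul hi)

/-- The first sum that defines `M₂ f` is a legitimate formal sum, for every `f`. -/
theorem summable_joinTerm (f : Series) : FormallySummable (joinTerm f) := by
  intro α
  refine (α.support.finite_toSet.prod α.support.finite_toSet).subset fun p hp => ?_
  simp only [joinTerm, Set.mem_ofPred_eq, map_smul, smul_eq_mul] at hp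
  have h := right_ne_zero_of_mul hp
  refine ⟨coeff_q_mul_ne_zero (i := p.1) (f := q p.2 * del (p.1 + p.2 - 2) f) ?_,
    coeff_q_mul_ne_zero (i := p.2) (f := q p.1 * del (p.1 + p.2 - 2) f) ?_⟩
  · rwa [← mul_assoc]
  · rwa [← mul_assoc, mul_comm (q p.2)]

/-- The second sum that defines `M₂ f` is a legitimate formal sum, for every `f`. -/
theorem summable_cutTerm (f : Series) : FormallySummable (cutTerm f) := by
  intro α
  have hfin : (⋃ s ∈ α.support, {p : ℕ+ × ℕ+ | p.1 ≤ s ∧ p.2 ≤ s}).Finite := by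
    refine α.support.finite_toSet.biUnion fun s _ => ?_
    exact ((Set.finite_Iic s).prod (Set.finite_Iic s)).subset fun p hp => hp
  refine hfin.subset fun p hp => ?_
  simp only [cutTerm, Set.mem_ofPred_eq, map_smul, smul_eq_mul] at hp
  have h := coeff_q_mul_ne_zero (right_ne_zero_of_mul hp)
  simp only [Set.mem_iUnion]
  refine ⟨_, h, ?_, ?_⟩
  · rw [← PNat.coe_le_coe]; push_cast; omega
  · rw [← PNat.coe_le_coe]; push_cast; omega

end GJV

end

/-! Everything is read off from one series, `E = exp (∑ q_i f_i(z))` with `f_i = ((1 + z/2)^i - (1 -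
z/2)^i) / i`.

Hurwitz side. Let `A_b(s)` be the exponential generating series for multiplying a permutation with
cycle lengths `b_i` by transpositions until it is a full cycle. It is characterized by the
cut-and-join recursion, and `d · 2 sinh(ds/2) · A_b = ∏ 2 sinh(b_i d s/2)` solves it: joins give the
addition formula for sinh, cuts give a convolution of sinhs, and together they are the quotient rule
(`derivative_countSeries`, `facCount_eq`). Counting labelled permutations then gives `h / (d m!) =
d^(2g+n-3) [u^(2g)] ∏ S(b_i u) / S(u)`, where `S(u) = sinh(u/2) / (u/2)` (`hurwitz_formula`).

Brackets. Since `∑_d t^d f_{d+1}(z) / d! = z e^t S(zt)`, expanding this formula in the `b_i` writes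
the brackets explicitly: coefficients of `1/S` times `(2g+n-3)!` times coefficients of `∏ f_{d_i+1}
/ d_i!` (`gjv_formula`). They are unique because a polynomial is determined by its values at
positive integers. For `j = 0` the coefficient of `q^α` in `F` is `(p-3)! [z^p q^α] E`, where `p =
2g + n` and the weight `∑ i α_i` is `2p - 3` (`coeff_F`).

Operators. Let `W` multiply a monomial by its weight. Then `∂E/∂q_1 = zE`, `Λ₁ E = (W - z∂_z) E` and
`z M₂ E = (z∂_z - 1)(W - z∂_z) E`. So `M₂` sends the part of weight `w` and `z`-degree `p` to
`p(w+1-p)` times the part `(w+2, p+1)` (`M2_expPart`). Starting from `q_1`, the part `(1, 1)`, the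
factors are perfect squares and `M₂^k q_1 = k!² E_{2k+1,k+1}`; hence `exp(M₂) q_1 = ∑ k!
E_{2k+1,k+1}`. This is `∂²F/∂q_1²`, as each `∂/∂q_1` lowers the `z`-degree by one. The string
equation compares factorials in the same way. -/

noncomputable section

namespace GJV

/-! ### The series `E` in `z`: Euler operator, joins and cuts -/

section

open Polynomial Finset

/-- The linear polynomial `1 + z / 2`. -/
def upPoly : ℚ[X] := 1 + C (1 / 2) * X

/-- The linear polynomial `1 - z / 2`. -/
def downPoly : ℚ[X] := 1 - C (1 / 2) * X

/-- The polynomial `(1 + z / 2) ^ i - (1 - z / 2) ^ i`. -/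
def diffPoly (i : ℕ) : ℚ[X] := upPoly ^ i - downPoly ^ i

/-- The polynomial `((1 + z / 2) ^ i - (1 - z / 2) ^ i) / i`. -/
def varPoly (i : ℕ) : ℚ[X] := C (1 / (i : ℚ)) * diffPoly i

@[simp] lemma diffPoly_zero : diffPoly 0 = 0 := by simp [diffPoly]

lemma upPoly_sub_downPoly : upPoly - downPoly = X := by
  have : (C (1 / 2) : ℚ[X]) + C (1 / 2) = 1 := by rw [← C_add]; norm_num
  rw [upPoly, downPoly]; linear_combination X * this

lemma diffPoly_one : diffPoly 1 = X := by
  simp only [diffPoly, pow_one, upPoly_sub_downPoly]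

lemma natCast_mul_varPoly (i : ℕ) : (C (i : ℚ)) * varPoly i = diffPoly i := by
  rcases Nat.eq_zero_or_pos i with rfl | hi
  · simp
  · have : (i : ℚ) ≠ 0 := by positivity
    rw [varPoly, ← mul_assoc, ← C_mul, mul_one_div_cancel this, C_1, one_mul]

@[simp] lemma derivative_upPoly : derivative upPoly = C (1 / 2) := by
  rw [upPoly]; simp only [derivative_add, derivative_one, derivative_C_mul, derivative_X]; simp

@[simp] lemma derivative_downPoly : derivative downPoly = -C (1 / 2) := by
  rw [downPoly]; simp only [derivative_sub, derivative_one, derivative_C_mul, derivative_X]; simp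

lemma derivative_diffPoly (n : ℕ) :
    derivative (diffPoly (n + 1)) =
      C ((n : ℚ) + 1) * (C (1 / 2) * (upPoly ^ n + downPoly ^ n)) := by
  rw [diffPoly, derivative_sub, derivative_pow_succ, derivative_pow_succ, derivative_upPoly,
    derivative_downPoly]
  simp only [map_add, map_one, map_natCast]
  ring

lemma derivative_varPoly (n : ℕ) :
    derivative (varPoly (n + 1)) = C (1 / 2) * (upPoly ^ n + downPoly ^ n) := by
  rw [varPoly, derivative_C_mul, derivative_diffPoly, ← mul_assoc, ← C_mul]
  have : (1 / ((n + 1 : ℕ) : ℚ)) * ((n : ℚ) + 1) = 1 := by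
    push_cast; field_simp
  rw [this, C_1, one_mul]

/-- The extra factor `1 ± z/2` contributes exactly `z/2 · ((1 + z/2)^n + (1 - z/2)^n)`, which is `z
f_{n+1}'`. This index drop is why `W - z∂_z` acts on `E` as `Λ₁`. -/
lemma diffPoly_sub_X_mul_derivative (n : ℕ) :
    diffPoly (n + 1) - X * derivative (varPoly (n + 1)) = diffPoly n := by
  have hu : upPoly ^ (n + 1) = upPoly ^ n * (1 + C (1 / 2) * X) := pow_succ _ _
  have hd : downPoly ^ (n + 1) = downPoly ^ n * (1 - C (1 / 2) * X) := pow_succ _ _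
  rw [derivative_varPoly, diffPoly, diffPoly, hu, hd]
  ring

/-- The convolution of the polynomials `diffPoly`, with the index shifted by one. -/
def convPoly : ℕ → ℚ[X]
  | 0 => 0
  | n + 1 => ∑ p ∈ antidiagonal n, diffPoly p.1 * diffPoly p.2

/-- Expanding the product leaves `n + 1` copies of `x^n + y^n` minus two geometric sums. The
identity computes the cut term twice: for `x, y = 1 ± z/2` in `M₂`, and for `x, y = exp(±ds/2)` in
the Hurwitz recursion. -/
lemma sub_mul_sum_antidiagonal {R : Type*} [CommRing R] (x y : R) (n : ℕ) :
    (x - y) * ∑ p ∈ antidiagonal n, (x ^ p.1 - y ^ p.1) * (x ^ p.2 - y ^ p.2) =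
      (n : R) * ((x - y) * (x ^ n + y ^ n)) - (x + y) * (x ^ n - y ^ n) := by
  have h : (x - y) * ∑ p ∈ antidiagonal n, x ^ p.1 * y ^ p.2 = x ^ (n + 1) - y ^ (n + 1) := by
    rw [← (Commute.all x y).mul_geom_sum₂ (n + 1),
      Finset.Nat.sum_antidiagonal_eq_sum_range_succ (fun i j => x ^ i * y ^ j)]
    simp
  have h' : (x - y) * ∑ p ∈ antidiagonal n, y ^ p.1 * x ^ p.2 = x ^ (n + 1) - y ^ (n + 1) := by
    rw [← h, ← Finset.Nat.sum_antidiagonal_swap]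
    simp [mul_comm]
  have hc : ∑ p ∈ antidiagonal n, (x ^ p.1 - y ^ p.1) * (x ^ p.2 - y ^ p.2) =
      ((n : R) + 1) * (x ^ n + y ^ n)
      - ∑ p ∈ antidiagonal n, x ^ p.1 * y ^ p.2 - ∑ p ∈ antidiagonal n, y ^ p.1 * x ^ p.2 := by
    have : ((n : R) + 1) * (x ^ n + y ^ n) = ∑ p ∈ antidiagonal n, (x ^ n + y ^ n) := by
      rw [Finset.sum_const, Finset.Nat.card_antidiagonal, nsmul_eq_mul]; simp
    rw [this, ← Finset.sum_sub_distrib, ← Finset.sum_sub_distrib]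
    refine Finset.sum_congr rfl fun p hp => ?_
    rw [← HasAntidiagonal.mem_antidiagonal.1 hp, pow_add, pow_add]
    ring
  rw [hc]
  linear_combination -h - h'

lemma X_mul_convPoly (n : ℕ) :
    C (1 / 2) * (X * convPoly n) = X * derivative (diffPoly n) - diffPoly n := by
  have h2 : (C (1 / 2) : ℚ[X]) * 2 = 1 := by
    rw [show (2 : ℚ[X]) = C 2 from rfl, ← C_mul]; norm_num
  cases n with
  | zero => simp [convPoly]
  | succ n =>
    have h := sub_mul_sum_antidiagonal upPoly downPoly n
    have hs : upPoly + downPoly = 2 := by rw [upPoly, downPoly]; ring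
    rw [hs, upPoly_sub_downPoly] at h
    have hd := diffPoly_sub_X_mul_derivative n
    rw [derivative_varPoly] at hd
    rw [derivative_diffPoly, C_add, C_1, map_natCast]
    simp only [convPoly, diffPoly] at h hd ⊢
    linear_combination C (1 / 2) * h - (upPoly ^ n - downPoly ^ n) * h2 + hd

/-- The subtracted bracket is antisymmetric in `m` and `n`, so it drops out of the symmetric sum
over joined pairs; the rest is `2 f_{n+1}'` times `diffPoly m`. -/
lemma diffPoly_add (m n : ℕ) :
    diffPoly (m + n) = diffPoly m * (upPoly ^ n + downPoly ^ n)
      - (upPoly ^ m * downPoly ^ n - downPoly ^ m * upPoly ^ n) := by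
  simp only [diffPoly, pow_add]; ring

/-- The coefficient of `q ^ α` in `exp (∑ qᵢ fᵢ(z))`, where `fᵢ` is `varPoly i`. -/
def expCoeff (α : ℕ+ →₀ ℕ) : ℚ[X] :=
  α.prod fun i k => C (1 / (k ! : ℚ)) * varPoly i ^ k

/-- The weighted degree `∑ i αᵢ` of the monomial `q ^ α`. -/
def wt : (ℕ+ →₀ ℕ) →+ ℕ := Finsupp.weight (fun i : ℕ+ => (i : ℕ))

@[simp] lemma wt_single (i : ℕ+) (k : ℕ) : wt (Finsupp.single i k) = k * i := by
  simp [wt, Finsupp.weight_apply]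

lemma wt_eq_sum (α : ℕ+ →₀ ℕ) {s : Finset ℕ+} (hs : α.support ⊆ s) :
    wt α = ∑ i ∈ s, α i * (i : ℕ) := by
  simp [wt, Finsupp.weight_apply, Finsupp.sum_of_support_subset α hs]

lemma expCoeff_factor (α : ℕ+ →₀ ℕ) (i : ℕ+) :
    expCoeff α = C (1 / ((α i)! : ℚ)) * varPoly i ^ (α i) * expCoeff (α.erase i) := by
  rw [expCoeff, ← Finsupp.mul_prod_erase' α i _ (by simp)]
  rfl

/-- The equation `∂E/∂q_i = f_i E`, coefficient by coefficient. -/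
lemma succ_mul_expCoeff_add_single (α : ℕ+ →₀ ℕ) (i : ℕ+) :
    C ((α i : ℚ) + 1) * expCoeff (α + Finsupp.single i 1) = varPoly i * expCoeff α := by
  rw [expCoeff_factor _ i, expCoeff_factor α i]
  have h1 : (α + Finsupp.single i 1).erase i = α.erase i := by
    ext j
    by_cases h : j = i
    · simp [h]
    · simp [Finsupp.erase_ne h]
  have h2 : (α + Finsupp.single i 1 : ℕ+ →₀ ℕ) i = α i + 1 := by simp
  have h3 : (C ((α i : ℚ) + 1)) * (C (1 / ((α i + 1)! : ℚ)))  = C (1 / ((α i)! : ℚ)) := by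
    rw [← C_mul, Nat.factorial_succ]; congr 1; push_cast; field_simp
  rw [h1, h2, ← h3]; ring

/-- The coefficient of `q ^ α` in `q ^ β * exp (∑ qᵢ fᵢ(z))`. -/
def shiftCoeff (α β : ℕ+ →₀ ℕ) : ℚ[X] := if β ≤ α then expCoeff (α - β) else 0

lemma single_le_of_ne_zero {α : ℕ+ →₀ ℕ} {i : ℕ+} (h : α i ≠ 0) : Finsupp.single i 1 ≤ α := by
  rw [Finsupp.single_le_iff]; omega

lemma coeff_mul_expCoeff (α : ℕ+ →₀ ℕ) (i : ℕ+) :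
    C (α i : ℚ) * expCoeff α = varPoly i * shiftCoeff α (Finsupp.single i 1) := by
  by_cases h : α i = 0
  · have : ¬ Finsupp.single i 1 ≤ α := by rw [Finsupp.single_le_iff]; omega
    simp [shiftCoeff, this, h]
  · have h1 := single_le_of_ne_zero h
    have h2 := succ_mul_expCoeff_add_single (α - Finsupp.single i 1) i
    rw [tsub_add_cancel_of_le h1] at h2
    rw [shiftCoeff, if_pos h1, ← h2]
    congr 2
    have : (α i : ℚ) = ((α i - 1 : ℕ) : ℚ) + 1 := by
      rw [Nat.cast_sub (by omega)]; simp
    simp [this]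

lemma wt_mul_expCoeff (α : ℕ+ →₀ ℕ) {s : Finset ℕ+} (hs : α.support ⊆ s) :
    C (wt α : ℚ) * expCoeff α = ∑ i ∈ s, diffPoly i * shiftCoeff α (Finsupp.single i 1) := by
  rw [wt_eq_sum α hs]
  push_cast
  rw [map_sum, Finset.sum_mul]
  refine Finset.sum_congr rfl fun i _ => ?_
  rw [← natCast_mul_varPoly, mul_assoc, ← coeff_mul_expCoeff, C_mul]; ring

/-- The equation `∂E/∂z = ∑ q_i f_i' E`. A set `s` larger than the support is allowed so that one
index set serves for `α` and for the smaller exponents obtained by removing variables. -/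
lemma derivative_expCoeff (α : ℕ+ →₀ ℕ) {s : Finset ℕ+} (hs : α.support ⊆ s) :
    derivative (expCoeff α) =
      ∑ i ∈ s, derivative (varPoly i) * shiftCoeff α (Finsupp.single i 1) := by
  have h0 : ∀ β : ℕ+ →₀ ℕ, β.support ⊆ s →
      expCoeff β = ∏ i ∈ s, C (1 / ((β i)! : ℚ)) * varPoly i ^ (β i) := fun β hβ => by
    rw [expCoeff, Finsupp.prod_of_support_subset β hβ]; simp
  rw [h0 α hs, derivative_prod_finset]
  refine Finset.sum_congr rfl fun i hi => ?_
  by_cases h : α i = 0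
  · have : ¬ Finsupp.single i 1 ≤ α := by rw [Finsupp.single_le_iff]; omega
    simp [shiftCoeff, this, h]
  · have h1 := single_le_of_ne_zero h
    have hss : (α - Finsupp.single i 1).support ⊆ s :=
      (Finsupp.support_mono tsub_le_self).trans hs
    rw [shiftCoeff, if_pos h1, h0 _ hss, ← Finset.mul_prod_erase s _ hi]
    have h2 : ∏ j ∈ s.erase i, C (1 / (((α - Finsupp.single i 1 : ℕ+ →₀ ℕ) j)! : ℚ)) *
          varPoly j ^ ((α - Finsupp.single i 1 : ℕ+ →₀ ℕ) j) =
        ∏ j ∈ s.erase i, C (1 / ((α j)! : ℚ)) * varPoly j ^ (α j) := by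
      refine Finset.prod_congr rfl fun j hj => ?_
      have : i ≠ j := (Finset.ne_of_mem_erase hj).symm
      simp [this]
    obtain ⟨k, hk⟩ := Nat.exists_eq_succ_of_ne_zero h
    have h3 : C (1 / ((α i)! : ℚ)) * ((k : ℚ[X]) + 1) = C (1 / (k ! : ℚ)) := by
      rw [show ((k : ℚ[X]) + 1) = C ((k : ℚ) + 1) by simp, ← C_mul, hk, Nat.factorial_succ]
      congr 1; push_cast; field_simp
    have h4 : (α - Finsupp.single i 1 : ℕ+ →₀ ℕ) i = k := by simp [hk]
    rw [h2, h4, ← h3, derivative_C_mul, hk, derivative_pow_succ]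
    simp only [map_add, map_one, map_natCast]
    ring

lemma derivative_shiftCoeff (α : ℕ+ →₀ ℕ) (i : ℕ+) {s : Finset ℕ+} (hs : α.support ⊆ s) :
    derivative (shiftCoeff α (Finsupp.single i 1)) = ∑ j ∈ s, derivative (varPoly j) *
      shiftCoeff α (Finsupp.single i 1 + Finsupp.single j 1) := by
  by_cases h : Finsupp.single i 1 ≤ α
  · rw [shiftCoeff, if_pos h,
      derivative_expCoeff _ ((Finsupp.support_mono tsub_le_self).trans hs)]
    refine Finset.sum_congr rfl fun j _ => ?_
    simp only [shiftCoeff, tsub_tsub, le_tsub_iff_left h]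
  · have : ∀ j : ℕ+, ¬ (Finsupp.single i 1 + Finsupp.single j 1 ≤ α) := fun j hj =>
      h (le_trans le_self_add hj)
    simp [shiftCoeff, h, this]

/-- The coefficient of `q ^ α` in `(W - z ∂/∂z) exp (∑ qᵢ fᵢ(z))`, where `W` is the operator that
multiplies a monomial by its weighted degree. -/
def eulerCoeff (α : ℕ+ →₀ ℕ) : ℚ[X] := C (wt α : ℚ) * expCoeff α - X * derivative (expCoeff α)

/-- The right side is also `Λ₁ E`, because `(i-1) f_{i-1} = diffPoly (i-1)`. -/
lemma eulerCoeff_eq (α : ℕ+ →₀ ℕ) {s : Finset ℕ+} (hs : α.support ⊆ s) :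
    eulerCoeff α = ∑ i ∈ s, diffPoly i.natPred * shiftCoeff α (Finsupp.single i 1) := by
  rw [eulerCoeff, wt_mul_expCoeff α hs, derivative_expCoeff α hs, Finset.mul_sum,
    ← Finset.sum_sub_distrib]
  refine Finset.sum_congr rfl fun i _ => ?_
  rw [← diffPoly_sub_X_mul_derivative i.natPred, PNat.natPred_add_one]; ring

lemma coeff_eulerCoeff (α : ℕ+ →₀ ℕ) (p : ℕ) :
    (eulerCoeff α).coeff p = ((wt α : ℚ) - p) * (expCoeff α).coeff p := by
  rw [eulerCoeff, coeff_sub, coeff_C_mul]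
  cases p with
  | zero => simp
  | succ p => rw [coeff_X_mul, coeff_derivative]; push_cast; ring

/-- The operator `M₂` acts on `exp (∑ qᵢ fᵢ(z))` as a differential operator in `z`. -/
lemma X_mul_join_add_cut (α : ℕ+ →₀ ℕ) {s : Finset ℕ+} (hs : α.support ⊆ s) :
    C (1 / 2) * (X * (∑ i ∈ s, ∑ j ∈ s, diffPoly (i.natPred + j.natPred) *
        shiftCoeff α (Finsupp.single i 1 + Finsupp.single j 1) +
      ∑ i ∈ s, convPoly i.natPred * shiftCoeff α (Finsupp.single i 1))) =
    X * derivative (eulerCoeff α) - eulerCoeff α := by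
  have hd : derivative (eulerCoeff α) =
      ∑ i ∈ s, derivative (diffPoly i.natPred) * shiftCoeff α (Finsupp.single i 1) +
      ∑ i ∈ s, ∑ j ∈ s, diffPoly i.natPred * (derivative (varPoly j) *
        shiftCoeff α (Finsupp.single i 1 + Finsupp.single j 1)) := by
    rw [eulerCoeff_eq α hs, derivative_sum, ← Finset.sum_add_distrib]
    refine Finset.sum_congr rfl fun i _ => ?_
    rw [derivative_mul, derivative_shiftCoeff α i hs, Finset.mul_sum]
  have hj : C (1 / 2) * ∑ i ∈ s, ∑ j ∈ s, diffPoly (i.natPred + j.natPred) *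
        shiftCoeff α (Finsupp.single i 1 + Finsupp.single j 1) =
      ∑ i ∈ s, ∑ j ∈ s, diffPoly i.natPred * (derivative (varPoly j) *
        shiftCoeff α (Finsupp.single i 1 + Finsupp.single j 1)) := by
    -- The antisymmetric part of `diffPoly_add` cancels under exchanging `i` and `j`.
    have h1 : ∑ i ∈ s, ∑ j ∈ s, (upPoly ^ i.natPred * downPoly ^ j.natPred) *
          shiftCoeff α (Finsupp.single i 1 + Finsupp.single j 1) =
        ∑ i ∈ s, ∑ j ∈ s, (downPoly ^ i.natPred * upPoly ^ j.natPred) *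
          shiftCoeff α (Finsupp.single i 1 + Finsupp.single j 1) := by
      rw [Finset.sum_comm]
      refine Finset.sum_congr rfl fun i _ => Finset.sum_congr rfl fun j _ => ?_
      rw [add_comm (Finsupp.single j 1), mul_comm (upPoly ^ _)]
    rw [← sub_eq_zero]
    have h2 := congrArg (fun t => C (-(1 / 2) : ℚ) * t) (sub_eq_zero.2 h1)
    simp only [mul_zero, Finset.mul_sum, ← Finset.sum_sub_distrib] at h2
    simp only [Finset.mul_sum, ← Finset.sum_sub_distrib]
    rw [← h2]
    refine Finset.sum_congr rfl fun i _ => Finset.sum_congr rfl fun j _ => ?_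
    rw [← PNat.natPred_add_one j, derivative_varPoly, diffPoly_add, C_neg]
    ring
  have hc : C (1 / 2) * (X * ∑ i ∈ s, convPoly i.natPred * shiftCoeff α (Finsupp.single i 1)) =
      X * ∑ i ∈ s, derivative (diffPoly i.natPred) * shiftCoeff α (Finsupp.single i 1)
        - eulerCoeff α := by
    rw [eulerCoeff_eq α hs]
    simp only [Finset.mul_sum, ← Finset.sum_sub_distrib]
    refine Finset.sum_congr rfl fun i _ => ?_
    linear_combination X_mul_convPoly i.natPred * shiftCoeff α (Finsupp.single i 1)
  rw [hd]
  linear_combination X * hj + hc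

lemma coeff_join_add_cut (α : ℕ+ →₀ ℕ) {s : Finset ℕ+} (hs : α.support ⊆ s) (p : ℕ) :
    1 / 2 * (∑ i ∈ s, ∑ j ∈ s, diffPoly (i.natPred + j.natPred) *
        shiftCoeff α (Finsupp.single i 1 + Finsupp.single j 1) +
      ∑ i ∈ s, convPoly i.natPred * shiftCoeff α (Finsupp.single i 1)).coeff p =
    (p : ℚ) * ((wt α : ℚ) - (p + 1)) * (expCoeff α).coeff (p + 1) := by
  have h := congrArg (fun t => t.coeff (p + 1)) (X_mul_join_add_cut α hs)
  simp only [coeff_C_mul, coeff_X_mul, coeff_sub, coeff_derivative, coeff_eulerCoeff] at h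
  rw [h]; push_cast; ring

end

/-! ### The action of `M₂` on homogeneous parts of `E`, and `exp(M₂) q_1` -/

section

open Polynomial Finset

lemma coeff_formalSum {ι : Type} (f : ι → Series) (α : ℕ+ →₀ ℕ) :
    MvPowerSeries.coeff α (formalSum f) = ∑ᶠ i, MvPowerSeries.coeff α (f i) := rfl

lemma q_eq_monomial (i : ℕ+) :
    q i = MvPowerSeries.monomial (Finsupp.single i 1) (1 : ℚ) := rfl

lemma coeff_q_mul (i : ℕ+) (f : Series) (α : ℕ+ →₀ ℕ) :
    MvPowerSeries.coeff α (q i * f) = if Finsupp.single i 1 ≤ α then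
      MvPowerSeries.coeff (α - Finsupp.single i 1) f else 0 := by
  rw [q_eq_monomial, MvPowerSeries.coeff_monomial_mul]; simp

lemma coeff_q_mul_q_mul (i j : ℕ+) (f : Series) (α : ℕ+ →₀ ℕ) :
    MvPowerSeries.coeff α (q i * q j * f) =
      if Finsupp.single i 1 + Finsupp.single j 1 ≤ α then
        MvPowerSeries.coeff (α - (Finsupp.single i 1 + Finsupp.single j 1)) f else 0 := by
  rw [q_eq_monomial, q_eq_monomial, MvPowerSeries.monomial_mul_monomial,
    MvPowerSeries.coeff_monomial_mul]; simp

lemma coeff_del (i : ℕ+) (f : Series) (α : ℕ+ →₀ ℕ) :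
    MvPowerSeries.coeff α (del i f) =
      ((α i : ℚ) + 1) * MvPowerSeries.coeff (α + Finsupp.single i 1) f := by
  rw [del, MvPowerSeries.coeff_pderiv, mul_comm]

/-- The `z ^ p`-coefficient of the part of weighted degree `w` of `exp (∑ qᵢ fᵢ(z))`. -/
def expPart (w p : ℕ) : Series := fun α => if wt α = w then (expCoeff α).coeff p else 0

lemma coeff_expPart (w p : ℕ) (α : ℕ+ →₀ ℕ) :
    MvPowerSeries.coeff α (expPart w p) = if wt α = w then (expCoeff α).coeff p else 0 := rfl

lemma coeff_del_expPart (w p : ℕ) (i : ℕ+) (α : ℕ+ →₀ ℕ) :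
    MvPowerSeries.coeff α (del i (expPart w p)) =
      if wt α + i = w then (varPoly i * expCoeff α).coeff p else 0 := by
  rw [coeff_del, coeff_expPart, map_add, wt_single, one_mul, mul_ite, mul_zero, ← coeff_C_mul,
    succ_mul_expCoeff_add_single]

lemma coeff_del_del_expPart (w p : ℕ) (i j : ℕ+) (α : ℕ+ →₀ ℕ) :
    MvPowerSeries.coeff α (del i (del j (expPart w p))) =
      if wt α + (i + j) = w then (varPoly i * varPoly j * expCoeff α).coeff p else 0 := by
  rw [coeff_del, coeff_del_expPart, map_add, wt_single, one_mul, mul_ite, mul_zero, ← coeff_C_mul,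
    mul_left_comm, succ_mul_expCoeff_add_single, add_assoc]
  congr 2; ring

lemma wt_tsub {α β : ℕ+ →₀ ℕ} (h : β ≤ α) : wt (α - β) + wt β = wt α := by
  rw [← map_add, tsub_add_cancel_of_le h]

lemma coe_add_sub_two {i j : ℕ+} (h : i.natPred + j.natPred ≠ 0) :
    ((i + j - 2 : ℕ+) : ℕ) = i.natPred + j.natPred := by
  have hi := PNat.natPred_add_one i
  have hj := PNat.natPred_add_one j
  have hlt : (2 : ℕ+) < i + j := by
    rw [← PNat.coe_lt_coe, PNat.add_coe]; change 2 < _; omega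
  rw [PNat.sub_coe, if_pos hlt, PNat.add_coe]; change _ - 2 = _; omega

lemma cast_coe_eq (i : ℕ+) : ((i : ℕ) : ℚ) = (i.natPred : ℚ) + 1 := by
  rw [← PNat.natPred_add_one i]; push_cast; simp

lemma coeff_joinTerm_expPart (w p : ℕ) (ij : ℕ+ × ℕ+) (α : ℕ+ →₀ ℕ) :
    MvPowerSeries.coeff α (joinTerm (expPart w p) ij) = if wt α = w + 2 then
      (diffPoly (ij.1.natPred + ij.2.natPred) *
        shiftCoeff α (Finsupp.single ij.1 1 + Finsupp.single ij.2 1)).coeff p else 0 := by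
  obtain ⟨i, j⟩ := ij
  have hc : ((i : ℕ) : ℚ) + ((j : ℕ) : ℚ) - 2 = ((i.natPred + j.natPred : ℕ) : ℚ) := by
    rw [cast_coe_eq, cast_coe_eq]; push_cast; ring
  simp only [joinTerm, map_smul, smul_eq_mul, hc, coeff_q_mul_q_mul]
  -- For `i = j = 1` the truncated index `i + j - 2` in `ℕ+` is meaningless, but the factor `i + j -
  -- 2` is zero.
  by_cases h0 : i.natPred + j.natPred = 0
  · simp [h0]
  by_cases hle : Finsupp.single i 1 + Finsupp.single j 1 ≤ α
  · have hw := wt_tsub hle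
    rw [map_add, wt_single, wt_single] at hw
    have hi := PNat.natPred_add_one i
    have hj := PNat.natPred_add_one j
    have hiff : wt (α - (Finsupp.single i 1 + Finsupp.single j 1)) + (i.natPred + j.natPred) = w ↔
        wt α = w + 2 := by omega
    simp only [hle, if_true, coeff_del_expPart, coe_add_sub_two h0, shiftCoeff, mul_ite, mul_zero,
      ← coeff_C_mul, ← mul_assoc, natCast_mul_varPoly, hiff]
  · simp [hle, shiftCoeff]

lemma coeff_cutTerm_expPart (w p : ℕ) (ij : ℕ+ × ℕ+) (α : ℕ+ →₀ ℕ) :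
    MvPowerSeries.coeff α (cutTerm (expPart w p) ij) = if wt α = w + 2 then
      (diffPoly ij.1 * diffPoly ij.2 *
        shiftCoeff α (Finsupp.single (ij.1 + ij.2 + 2) 1)).coeff p else 0 := by
  obtain ⟨i, j⟩ := ij
  simp only [cutTerm, map_smul, smul_eq_mul, coeff_q_mul]
  by_cases hle : Finsupp.single (i + j + 2) 1 ≤ α
  · have hw := wt_tsub hle
    rw [wt_single, PNat.add_coe, PNat.add_coe] at hw
    change _ + 1 * (_ + 2) = _ at hw
    have hiff : wt (α - Finsupp.single (i + j + 2) 1) + (i + j : ℕ) = w ↔ wt α = w + 2 := by omega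
    simp only [hle, if_true, coeff_del_del_expPart, shiftCoeff, hiff, mul_ite, mul_zero,
      ← coeff_C_mul]
    rw [← natCast_mul_varPoly i, ← natCast_mul_varPoly j, C_mul]
    congr 2; ring
  · simp [hle, shiftCoeff]

lemma coeff_join_expPart (w p : ℕ) (α : ℕ+ →₀ ℕ) :
    MvPowerSeries.coeff α (formalSum (joinTerm (expPart w p))) = if wt α = w + 2 then
      (∑ i ∈ α.support, ∑ j ∈ α.support, diffPoly (i.natPred + j.natPred) *
        shiftCoeff α (Finsupp.single i 1 + Finsupp.single j 1)).coeff p else 0 := by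
  rw [coeff_formalSum, finsum_eq_sum_of_support_subset (s := α.support ×ˢ α.support),
    Finset.sum_product]
  · simp only [coeff_joinTerm_expPart, finsetSum_coeff]
    split_ifs <;> simp
  · rintro ⟨i, j⟩ hij
    simp only [Function.mem_support, joinTerm, map_smul, smul_eq_mul] at hij
    have h := right_ne_zero_of_mul hij
    rw [Finset.coe_product]
    refine ⟨coeff_q_mul_ne_zero (i := i) (f := q j * del (i + j - 2) (expPart w p)) ?_,
      coeff_q_mul_ne_zero (i := j) (f := q i * del (i + j - 2) (expPart w p)) ?_⟩
    · rwa [← mul_assoc]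
    · rwa [← mul_assoc, mul_comm (q j)]

lemma convPoly_natPred (k : ℕ+) {M : ℕ+} (hM : k ≤ M) :
    convPoly k.natPred = ∑ ij ∈ Finset.Icc 1 M ×ˢ Finset.Icc 1 M with ij.1 + ij.2 + 2 = k,
      diffPoly (ij.1 : ℕ+) * diffPoly (ij.2 : ℕ+) := by
  have hk := PNat.natPred_add_one k
  cases hn : k.natPred with
  | zero =>
    rw [convPoly, Finset.filter_false_of_mem, Finset.sum_empty]
    rintro ⟨i, j⟩ _ h
    have := congrArg PNat.val h
    simp only [PNat.val_ofNat, PNat.add_coe] at this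
    omega
  | succ n =>
    rw [convPoly]
    -- The antidiagonal also contains pairs with a zero entry, which have no counterpart in `ℕ+`;
    -- they vanish since `diffPoly 0 = 0`.
    symm
    refine Finset.sum_bij_ne_zero (fun ij _ _ => ((ij.1 : ℕ), (ij.2 : ℕ))) ?_ ?_ ?_ ?_
    · rintro ⟨i, j⟩ h _
      have := congrArg PNat.val (Finset.mem_filter.1 h).2
      simp only [PNat.val_ofNat, PNat.add_coe] at this
      rw [HasAntidiagonal.mem_antidiagonal]
      dsimp only
      omega
    · rintro ⟨i, j⟩ _ _ ⟨i', j'⟩ _ _ h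
      simpa using h
    · rintro ⟨i, j⟩ h h0
      rw [HasAntidiagonal.mem_antidiagonal] at h
      dsimp only at h h0
      have hi : 0 < i := Nat.pos_of_ne_zero fun h => h0 (by simp [h])
      have hj : 0 < j := Nat.pos_of_ne_zero fun h => h0 (by simp [h])
      have hM' : (k : ℕ) ≤ M := hM
      refine ⟨(⟨i, hi⟩, ⟨j, hj⟩), Finset.mem_filter.2 ⟨Finset.mem_product.2
        ⟨Finset.mem_Icc.2 ⟨one_le, ?_⟩, Finset.mem_Icc.2 ⟨one_le, ?_⟩⟩, PNat.eq ?_⟩, h0, rfl⟩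
      · change i ≤ (M : ℕ); omega
      · change j ≤ (M : ℕ); omega
      · change i + j + 2 = (k : ℕ); omega
    · rintro ⟨i, j⟩ _ _
      rfl

/-- The pairs `(i, j)` are grouped by the index `k = i + j + 2` of the created variable; each group
sums to `convPoly (k - 1)`. -/
lemma coeff_cut_expPart (w p : ℕ) (α : ℕ+ →₀ ℕ) :
    MvPowerSeries.coeff α (formalSum (cutTerm (expPart w p))) = if wt α = w + 2 then
      (∑ k ∈ α.support, convPoly k.natPred * shiftCoeff α (Finsupp.single k 1)).coeff p else 0 := by
  obtain ⟨M, hM⟩ : ∃ M : ℕ+, ∀ k ∈ α.support, k ≤ M := by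
    obtain ⟨M, hM⟩ := α.support.bddAbove
    exact ⟨M, fun k hk => hM hk⟩
  rw [coeff_formalSum,
    finsum_eq_sum_of_support_subset (s := {ij ∈ Finset.Icc 1 M ×ˢ Finset.Icc 1 M |
      ij.1 + ij.2 + 2 ∈ α.support})]
  · rw [← Finset.sum_fiberwise_of_maps_to (t := α.support) (g := fun ij : ℕ+ × ℕ+ => ij.1 + ij.2 + 2)
      (fun ij h => (Finset.mem_filter.1 h).2)]
    simp only [coeff_cutTerm_expPart]
    split_ifs
    · rw [finsetSum_coeff]
      refine Finset.sum_congr rfl fun k hk => ?_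
      rw [convPoly_natPred k (hM k hk), Finset.sum_mul, finsetSum_coeff, Finset.filter_filter]
      refine Finset.sum_congr ?_ ?_
      · ext ij
        simp only [Finset.mem_filter, and_congr_right_iff, and_iff_right_iff_imp]
        rintro _ rfl
        exact hk
      · intro ij hij
        rw [(Finset.mem_filter.1 hij).2]
    · simp
  · intro ij hij
    simp only [Function.mem_support, cutTerm, map_smul, smul_eq_mul] at hij
    have h := coeff_q_mul_ne_zero (right_ne_zero_of_mul hij)
    have h2 : ((ij.1 + ij.2 + 2 : ℕ+) : ℕ) ≤ M := hM _ h
    simp only [PNat.add_coe, PNat.val_ofNat] at h2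
    simp only [Finset.coe_filter, Finset.mem_product, Finset.mem_Icc,
      Set.mem_ofPred_eq, h, and_true, ← PNat.coe_le_coe, PNat.val_ofNat]
    have h3 := ij.1.pos
    have h4 := ij.2.pos
    omega

/-- `M₂` acts on the homogeneous parts of the coefficients of `exp (∑ qᵢ fᵢ(z))`. -/
lemma M2_expPart (w p : ℕ) :
    M2 (expPart w p) = ((p : ℚ) * ((w : ℚ) + 1 - p)) • expPart (w + 2) (p + 1) := by
  ext α
  rw [M2, map_add, map_smul, map_smul, map_smul, coeff_join_expPart, coeff_cut_expPart,
    coeff_expPart, smul_eq_mul, smul_eq_mul, smul_eq_mul]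
  split_ifs with h
  · rw [← mul_add, ← coeff_add, coeff_join_add_cut α (Finset.Subset.refl _), h]
    push_cast; ring
  · simp

/-- Homogeneity is enough: every iterate of `M₂` on `q_1` is a multiple of a single homogeneous
part, so additivity is never used. -/
lemma M2_smul (c : ℚ) (f : Series) : M2 (c • f) = c • M2 f := by
  have hd : ∀ i g, del i (c • g) = c • del i g := fun i g => by simp [del]
  have hj : formalSum (joinTerm (c • f)) = c • formalSum (joinTerm f) := by
    ext α
    rw [map_smul, coeff_formalSum, coeff_formalSum, smul_finsum']
    · refine finsum_congr fun p => ?_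
      rw [joinTerm, joinTerm, hd, mul_smul_comm, smul_comm, map_smul]
    · exact summable_joinTerm f α
  have hc : formalSum (cutTerm (c • f)) = c • formalSum (cutTerm f) := by
    ext α
    rw [map_smul, coeff_formalSum, coeff_formalSum, smul_finsum']
    · refine finsum_congr fun p => ?_
      rw [cutTerm, cutTerm, hd, hd, mul_smul_comm, smul_comm, map_smul]
    · exact summable_cutTerm f α
  rw [M2, M2, hj, hc, smul_add, smul_comm c, smul_comm c]

lemma expPart_one_one : expPart 1 1 = q 1 := by
  ext α
  rw [coeff_expPart, q_eq_monomial, MvPowerSeries.coeff_monomial]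
  by_cases h : α = Finsupp.single 1 1
  · subst h
    simp [expCoeff, varPoly, diffPoly_one]
  · rw [if_neg h, if_neg]
    intro hw
    apply h
    rw [wt_eq_sum α (Finset.Subset.refl _)] at hw
    have h1 : ∀ i ∈ α.support, i = 1 ∧ α i = 1 := fun i hi => by
      have h2 := Finset.single_le_sum (f := fun i => α i * (i : ℕ)) (fun _ _ => Nat.zero_le _) hi
      rw [hw] at h2
      have h3 : α i * (i : ℕ) = 1 :=
        le_antisymm h2 (Nat.mul_pos (Nat.pos_of_ne_zero (Finsupp.mem_support_iff.1 hi)) i.pos)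
      rw [mul_eq_one] at h3
      exact ⟨PNat.coe_eq_one_iff.1 h3.2, h3.1⟩
    have hne : α.support.Nonempty := by
      by_contra hne
      rw [Finset.not_nonempty_iff_eq_empty] at hne
      simp [hne] at hw
    obtain ⟨i, hi⟩ := hne
    have hi1 := h1 i hi
    ext j
    by_cases hj : j ∈ α.support
    · rw [(h1 j hj).1, ← hi1.1, Finsupp.single_eq_same, hi1.2]
    · have : (1 : ℕ+) ≠ j := by rintro rfl; exact hj (hi1.1 ▸ hi)
      rw [Finsupp.notMem_support_iff.1 hj, Finsupp.single_eq_of_ne' this]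

/-- At `w = 2k + 1`, `p = k + 1` the factor `p(w + 1 - p)` equals `(k + 1)²`. -/
lemma M2_iterate_q_one (k : ℕ) :
    M2^[k] (q 1) = ((k ! : ℚ) ^ 2) • expPart (2 * k + 1) (k + 1) := by
  induction k with
  | zero => simp [expPart_one_one]
  | succ k ih =>
    rw [Function.iterate_succ_apply', ih, M2_smul, M2_expPart, smul_smul, Nat.factorial_succ]
    congr 1
    push_cast; ring

lemma expTerm_M2_q_one (k : ℕ) :
    expTerm M2 (q 1) k = (k ! : ℚ) • expPart (2 * k + 1) (k + 1) := by
  rw [expTerm, M2_iterate_q_one, smul_smul]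
  congr 1
  have : (k ! : ℚ) ≠ 0 := by positivity
  field_simp

/-- `M₂` raises the weight by two, so a monomial of weight `2k + 1` sees only the `k`-th term, and
one of even weight sees none. -/
theorem summable_expTerm_M2_q_one : FormallySummable (expTerm M2 (q 1)) := by
  intro α
  refine (Set.finite_singleton ((wt α - 1) / 2)).subset fun k hk => ?_
  rw [Set.mem_ofPred_eq, expTerm_M2_q_one, map_smul, coeff_expPart] at hk
  have : wt α = 2 * k + 1 := by by_contra h; simp [h] at hk
  rw [Set.mem_singleton_iff]; omega

theorem coeff_expOp_M2_q_one (k : ℕ) (α : ℕ+ →₀ ℕ) (h : wt α = 2 * k + 1) :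
    MvPowerSeries.coeff α (expOp M2 (q 1)) = k ! * (expCoeff α).coeff (k + 1) := by
  rw [expOp, coeff_formalSum, finsum_eq_single _ k]
  · rw [expTerm_M2_q_one, map_smul, coeff_expPart, if_pos h, smul_eq_mul]
  · intro j hj
    rw [expTerm_M2_q_one, map_smul, coeff_expPart, if_neg (by omega), smul_zero]

theorem coeff_expOp_M2_q_one_of_even (α : ℕ+ →₀ ℕ) (h : Even (wt α)) :
    MvPowerSeries.coeff α (expOp M2 (q 1)) = 0 := by
  rw [expOp, coeff_formalSum]
  refine finsum_eq_zero_of_forall_eq_zero fun j => ?_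
  obtain ⟨r, hr⟩ := h
  rw [expTerm_M2_q_one, map_smul, coeff_expPart, if_neg (by omega), smul_zero]

end

/-! ### Explicit brackets, the coefficients of `F`, and its two equations -/

section

open Polynomial Finset

/-- The power series `sinh (u / 2) / (u / 2)`. -/
def sinhc : PowerSeries ℚ :=
  PowerSeries.mk fun n => if Even n then 1 / (2 ^ n * ((n + 1)! : ℚ)) else 0

lemma coeff_sinhc (n : ℕ) : PowerSeries.coeff n sinhc =
    if Even n then 1 / (2 ^ n * ((n + 1)! : ℚ)) else 0 := PowerSeries.coeff_mk _ _

lemma constantCoeff_sinhc : PowerSeries.constantCoeff sinhc = 1 := by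
  rw [← PowerSeries.coeff_zero_eq_constantCoeff_apply, coeff_sinhc]; simp

lemma coeff_upPoly_pow (n p : ℕ) : (upPoly ^ n).coeff p = n.choose p * (1 / 2 : ℚ) ^ p := by
  have : upPoly ^ n = ((1 + X) ^ n : ℚ[X]).comp (C (1 / 2) * X) := by simp [upPoly]
  rw [this, comp_C_mul_X_coeff, coeff_one_add_X_pow]

lemma coeff_downPoly_pow (n p : ℕ) : (downPoly ^ n).coeff p = n.choose p * (-(1 / 2) : ℚ) ^ p := by
  have : downPoly ^ n = ((1 + X) ^ n : ℚ[X]).comp (C (-(1 / 2)) * X) := by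
    simp [downPoly, sub_eq_add_neg]
  rw [this, comp_C_mul_X_coeff, coeff_one_add_X_pow]

lemma coeff_varPoly (n p : ℕ) : (varPoly n).coeff p =
    1 / (n : ℚ) * (n.choose p * ((1 / 2) ^ p - (-(1 / 2)) ^ p)) := by
  rw [varPoly, coeff_C_mul, diffPoly, coeff_sub, coeff_upPoly_pow, coeff_downPoly_pow]
  ring

/-- This is `∑_d t^d f_{d+1}(z) / d! = z e^t S(zt)`, with `S` the series `sinhc`. It links the
polynomials of the operator side with the hyperbolic sines of the Hurwitz side. -/
lemma varPoly_div_factorial (d : ℕ) : C (1 / (d ! : ℚ)) * varPoly (d + 1) =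
    X * ∑ p ∈ antidiagonal d,
      C (1 / (p.1 ! : ℚ)) * (C (PowerSeries.coeff p.2 sinhc) * X ^ p.2) := by
  ext p
  rw [coeff_C_mul, coeff_varPoly]
  cases p with
  | zero => simp
  | succ p =>
    simp only [coeff_X_mul, finsetSum_coeff, coeff_C_mul, coeff_X_pow]
    rw [Finset.Nat.sum_antidiagonal_eq_sum_range_succ
      (fun k l => 1 / (k ! : ℚ) * (PowerSeries.coeff l sinhc * if p = l then 1 else 0))]
    by_cases hp : p ≤ d
    · rw [Finset.sum_eq_single (d - p)]
      · rw [coeff_sinhc, Nat.sub_sub_self hp, if_pos rfl]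
        rw [Nat.cast_choose ℚ (by omega : p + 1 ≤ d + 1), Nat.add_sub_add_right]
        have h1 : ((d - p)! : ℚ) ≠ 0 := by positivity
        have h2 : ((p + 1)! : ℚ) ≠ 0 := by positivity
        have h3 : (d ! : ℚ) ≠ 0 := by positivity
        rw [Nat.factorial_succ d]
        push_cast
        by_cases he : Even p
        · rw [if_pos he, (Even.add_one he).neg_pow, one_div_pow, pow_succ]
          field_simp
          ring
        · rw [if_neg he, (Odd.add_one (Nat.not_even_iff_odd.1 he)).neg_pow]
          simp
      · intro k hk hne
        rw [if_neg]
        · simp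
        · have := Finset.mem_range.1 hk; omega
      · intro h
        exact absurd (Finset.mem_range.2 (by omega)) h
    · rw [Finset.sum_eq_zero, Nat.choose_eq_zero_of_lt (by omega)]
      · simp
      · intro k hk
        rw [if_neg (by omega)]; simp

lemma exists_varPoly_eq (i : ℕ) : ∃ r : ℚ[X], varPoly i = X * expand ℚ 2 r := by
  cases i with
  | zero => exact ⟨0, by simp [varPoly]⟩
  | succ d =>
    refine ⟨C (d ! : ℚ) * ∑ p ∈ antidiagonal d,
      C (1 / (p.1 ! : ℚ)) * (C (PowerSeries.coeff p.2 sinhc) * X ^ (p.2 / 2)), ?_⟩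
    have h := congrArg (fun t => C (d ! : ℚ) * t) (varPoly_div_factorial d)
    have h3 : (d ! : ℚ) ≠ 0 := by positivity
    rw [← mul_assoc, ← C_mul, mul_one_div_cancel h3, C_1, one_mul] at h
    rw [h, mul_left_comm, map_mul, expand_C, map_sum]
    congr 2
    refine Finset.sum_congr rfl fun p _ => ?_
    rw [map_mul, map_mul, expand_C, expand_C, map_pow, expand_X, ← pow_mul]
    by_cases he : Even p.2
    · rw [Nat.mul_div_cancel' he.two_dvd]
    · simp [coeff_sinhc, he]

/-- Each `f_i` is odd in `z`, so the coefficient of `q^α` in `E` has the parity of the number of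
points and is divisible by that power of `z`. A nonzero coefficient of `z^p` therefore forces `p =
2g + n`, which is the dimension constraint. -/
lemma exists_expCoeff_eq (α : ℕ+ →₀ ℕ) :
    ∃ r : ℚ[X], expCoeff α = X ^ (α.sum fun _ e => e) * expand ℚ 2 r := by
  choose r hr using exists_varPoly_eq
  refine ⟨α.prod fun i k => C (1 / (k ! : ℚ)) * r i ^ k, ?_⟩
  simp only [expCoeff, Finsupp.prod, Finsupp.sum, hr, mul_pow, Finset.prod_mul_distrib,
    Finset.prod_pow_eq_pow_sum, map_mul, map_prod, map_pow, expand_C]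
  ring

lemma exists_of_coeff_expCoeff_ne_zero {α : ℕ+ →₀ ℕ} {p : ℕ} (h : (expCoeff α).coeff p ≠ 0) :
    ∃ g, p = 2 * g + α.sum fun _ e => e := by
  obtain ⟨r, hr⟩ := exists_expCoeff_eq α
  rw [hr, coeff_X_pow_mul', coeff_expand two_pos] at h
  split_ifs at h with h1 h2
  · obtain ⟨g, hg⟩ := h2
    exact ⟨g, by omega⟩
  all_goals exact absurd rfl h

/-- The product of the polynomials `varPoly (i + 1) / i!` over the exponent vector `k`. -/
def bracketPoly (k : ℕ →₀ ℕ) : ℚ[X] := k.prod fun i e => (C (1 / (i ! : ℚ)) * varPoly (i + 1)) ^ e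

/-- The number of points of the bracket with exponent vector `k`. -/
def numPts (k : ℕ →₀ ℕ) : ℕ := k.sum fun _ e => e

/-- The total degree of the bracket with exponent vector `k`. -/
def totDeg (k : ℕ →₀ ℕ) : ℕ := k.sum fun i e => i * e

open Classical in
/-- An explicit expression for the Goulden-Jackson-Vakil numbers. -/
def gjv (j : ℕ) (k : ℕ →₀ ℕ) : ℚ :=
  -- In this branch the quotient by four is exact and equals the genus `g`.
  if ∃ g, j ≤ g ∧ 4 * g + numPts k = 2 * j + totDeg k + 3 then
    (-1) ^ j * PowerSeries.coeff (2 * j) sinhc⁻¹ *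
      ((2 * ((2 * j + totDeg k + 3 - numPts k) / 4) + numPts k - 3)! *
        (bracketPoly k).coeff (2 * ((2 * j + totDeg k + 3 - numPts k) / 4 - j) + numPts k))
  else 0

lemma gjv_eq {g j : ℕ} {k : ℕ →₀ ℕ} (hj : j ≤ g)
    (h : 4 * g + numPts k = 2 * j + totDeg k + 3) :
    gjv j k = (-1) ^ j * PowerSeries.coeff (2 * j) sinhc⁻¹ *
      ((2 * g + numPts k - 3)! * (bracketPoly k).coeff (2 * (g - j) + numPts k)) := by
  have : (2 * j + totDeg k + 3 - numPts k) / 4 = g := by omega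
  rw [gjv, if_pos ⟨g, hj, h⟩, this]

/-- The normalization `((i-1)! q_i)^k / k!` in `F` cancels the factors `1 / (i-1)!` of the brackets.
-/
lemma expCoeff_eq_bracketPoly (α : ℕ+ →₀ ℕ) :
    expCoeff α = bracketPoly (α.mapDomain PNat.natPred) *
      C (α.prod fun i e => (((i.natPred)! : ℚ) ^ e) / (e ! : ℚ)) := by
  rw [bracketPoly, Finsupp.prod_mapDomain_index (by simp) (fun _ _ _ => pow_add _ _ _), expCoeff]
  simp only [Finsupp.prod]
  rw [map_prod, ← Finset.prod_mul_distrib]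
  refine Finset.prod_congr rfl fun i _ => ?_
  have h3 : ((i.natPred)! : ℚ) ≠ 0 := by positivity
  rw [PNat.natPred_add_one, mul_pow, mul_right_comm, ← C_pow, ← C_mul, one_div_pow]
  congr 2
  field_simp

lemma numPts_mapDomain (α : ℕ+ →₀ ℕ) :
    numPts (α.mapDomain PNat.natPred) = α.sum fun _ e => e :=
  Finsupp.sum_mapDomain_index (by simp) (by simp)

lemma totDeg_mapDomain (α : ℕ+ →₀ ℕ) :
    totDeg (α.mapDomain PNat.natPred) + (α.sum fun _ e => e) = wt α := by
  rw [totDeg, Finsupp.sum_mapDomain_index (by simp) (fun _ _ _ => mul_add _ _ _),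
    wt_eq_sum α (Finset.Subset.refl _), Finsupp.sum, Finsupp.sum, ← Finset.sum_add_distrib]
  refine Finset.sum_congr rfl fun i _ => ?_
  conv_rhs => rw [← PNat.natPred_add_one i]
  ring

lemma coeff_zero_inv_sinhc : PowerSeries.coeff 0 sinhc⁻¹ = 1 := by
  simp [constantCoeff_sinhc]

/-- Here `p = 2g + n`, because the weight is the total degree plus `n`. If no genus fits, the
bracket is zero by definition and the coefficient of `z^p` is zero by parity; this covers `p = 2`,
where `p - 3` is truncated. -/
lemma coeff_F (hb : bracket = gjv) {α : ℕ+ →₀ ℕ} {p : ℕ} (h : wt α + 3 = 2 * p) :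
    MvPowerSeries.coeff α F = (p - 3)! * (expCoeff α).coeff p := by
  have h0 : MvPowerSeries.coeff α F = bracket 0 (α.mapDomain PNat.natPred) *
    α.prod (fun i e => (((i.natPred)! : ℚ) ^ e) / (e ! : ℚ)) := rfl
  have hn := numPts_mapDomain α
  have hs := totDeg_mapDomain α
  rw [h0, hb]
  by_cases hg : ∃ g, 0 ≤ g ∧ 4 * g + numPts (α.mapDomain PNat.natPred) =
      2 * 0 + totDeg (α.mapDomain PNat.natPred) + 3
  · obtain ⟨g, hg0, hg⟩ := hg
    have h1 : 2 * g + numPts (α.mapDomain PNat.natPred) = p := by omega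
    rw [gjv_eq hg0 hg, Nat.sub_zero, h1, expCoeff_eq_bracketPoly, coeff_mul_C, mul_zero,
      coeff_zero_inv_sinhc]
    ring
  · rw [gjv, if_neg hg, zero_mul]
    symm
    by_contra hne
    obtain ⟨g, hg'⟩ := exists_of_coeff_expCoeff_ne_zero (right_ne_zero_of_mul hne)
    exact hg ⟨g, Nat.zero_le _, by omega⟩

lemma coeff_F_of_even (hb : bracket = gjv) {α : ℕ+ →₀ ℕ} (h : Even (wt α)) :
    MvPowerSeries.coeff α F = 0 := by
  have h0 : MvPowerSeries.coeff α F = bracket 0 (α.mapDomain PNat.natPred) *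
    α.prod (fun i e => (((i.natPred)! : ℚ) ^ e) / (e ! : ℚ)) := rfl
  have hn := numPts_mapDomain α
  have hs := totDeg_mapDomain α
  rw [h0, hb, gjv, if_neg, zero_mul]
  rintro ⟨g, _, hg⟩
  obtain ⟨r, hr⟩ := h
  omega

lemma varPoly_one : varPoly 1 = X := by simp [varPoly, diffPoly_one]

lemma coeff_del_one_F (hb : bracket = gjv) {α : ℕ+ →₀ ℕ} {p : ℕ} (h : wt α + 2 = 2 * p) :
    MvPowerSeries.coeff α (del 1 F) = (p - 2)! * (expCoeff α).coeff p := by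
  have h1 : wt (α + Finsupp.single 1 1) + 3 = 2 * (p + 1) := by
    rw [map_add, wt_single]; simp; omega
  have h2 : p + 1 - 3 = p - 2 := by omega
  rw [coeff_del, coeff_F hb h1, mul_left_comm, ← coeff_C_mul, succ_mul_expCoeff_add_single,
    PNat.one_coe, varPoly_one, coeff_X_mul, h2]

lemma coeff_del_one_F_of_odd (hb : bracket = gjv) {α : ℕ+ →₀ ℕ} (h : Odd (wt α)) :
    MvPowerSeries.coeff α (del 1 F) = 0 := by
  have h1 : Even (wt (α + Finsupp.single 1 1)) := by
    rw [map_add, wt_single]; simpa using h.add_one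
  rw [coeff_del, coeff_F_of_even hb h1, mul_zero]

theorem del_del_F (hb : bracket = gjv) : del 1 (del 1 F) = expOp M2 (q 1) := by
  ext α
  rw [coeff_del]
  rcases Nat.even_or_odd (wt α) with h | h
  · have h1 : Odd (wt (α + Finsupp.single 1 1)) := by
      rw [map_add, wt_single]; simpa using h.add_one
    rw [coeff_del_one_F_of_odd hb h1, coeff_expOp_M2_q_one_of_even _ h, mul_zero]
  · obtain ⟨k, hk⟩ := h
    have h1 : wt (α + Finsupp.single 1 1) + 2 = 2 * (k + 2) := by
      rw [map_add, wt_single]; simp; omega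
    rw [coeff_del_one_F hb h1, coeff_expOp_M2_q_one k α hk, mul_left_comm, ← coeff_C_mul,
      succ_mul_expCoeff_add_single, PNat.one_coe, varPoly_one, coeff_X_mul, Nat.add_sub_cancel]

lemma coe_sub_one {i : ℕ+} (h : i.natPred ≠ 0) : ((i - 1 : ℕ+) : ℕ) = i.natPred := by
  have hi := PNat.natPred_add_one i
  have hlt : (1 : ℕ+) < i := by
    rw [← PNat.coe_lt_coe, PNat.one_coe]; omega
  rw [PNat.sub_coe, if_pos hlt, PNat.one_coe]; omega

lemma coeff_Lambda1 (f : Series) (α : ℕ+ →₀ ℕ) :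
    MvPowerSeries.coeff α (Lambda1 f) =
      ∑ i ∈ α.support, MvPowerSeries.coeff α (Lambda1Term f i) := by
  rw [Lambda1, coeff_formalSum, finsum_eq_sum_of_support_subset]
  intro i hi
  simp only [Function.mem_support, Lambda1Term, map_smul, smul_eq_mul] at hi
  exact coeff_q_mul_ne_zero (right_ne_zero_of_mul hi)

/-- `Λ₁` raises the weight by one, so only coefficients of `f` one weight lower matter. On that
weight `F` is a constant times a `z`-coefficient of `E`, so the action on `E` applies. -/
lemma coeff_Lambda1Term (f : Series) (α : ℕ+ →₀ ℕ) (i : ℕ+) (c : ℚ) (p : ℕ)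
    (h : ∀ β, wt β + 1 = wt α → MvPowerSeries.coeff β f = c * (expCoeff β).coeff p) :
    MvPowerSeries.coeff α (Lambda1Term f i) =
      c * (diffPoly i.natPred * shiftCoeff α (Finsupp.single i 1)).coeff p := by
  have hc : ((i : ℕ) : ℚ) - 1 = (i.natPred : ℚ) := by rw [cast_coe_eq]; ring
  rw [Lambda1Term, map_smul, smul_eq_mul, coeff_q_mul, hc]
  by_cases h0 : i.natPred = 0
  · simp [h0]
  by_cases hle : Finsupp.single i 1 ≤ α
  · have hw := wt_tsub hle
    rw [wt_single] at hw
    have hi := PNat.natPred_add_one i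
    rw [if_pos hle, coeff_del, h, shiftCoeff, if_pos hle, mul_left_comm (_ + 1), ← coeff_C_mul,
      succ_mul_expCoeff_add_single, coe_sub_one h0, mul_left_comm, ← coeff_C_mul, ← mul_assoc,
      natCast_mul_varPoly]
    rw [map_add, wt_single, coe_sub_one h0]
    omega
  · simp [shiftCoeff, hle]

lemma wt_eq_two {α : ℕ+ →₀ ℕ} (h : wt α = 2) :
    α = Finsupp.single 1 2 ∨ α = Finsupp.single 2 1 := by
  have hle : ∀ i ∈ α.support, i = 1 ∨ i = 2 := fun i hi => by
    have h2 : α i * (i : ℕ) ≤ wt α := by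
      rw [wt_eq_sum α (Finset.Subset.refl _)]
      exact Finset.single_le_sum (f := fun i => α i * (i : ℕ)) (fun _ _ => Nat.zero_le _) hi
    have h3 := Nat.pos_of_ne_zero (Finsupp.mem_support_iff.1 hi)
    have h4 : (i : ℕ) ≤ 2 := by nlinarith
    have h5 := i.pos
    rw [← PNat.coe_inj, ← PNat.coe_inj, PNat.one_coe, PNat.val_ofNat]
    omega
  have hs : α.support ⊆ {1, 2} := fun i hi => by simpa using hle i hi
  have hne : (1 : ℕ+) ≠ 2 := by decide
  have hsum := wt_eq_sum α hs
  rw [h, Finset.sum_pair hne, PNat.one_coe, PNat.val_ofNat] at hsum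
  have hz : ∀ i, i ≠ 1 → i ≠ 2 → α i = 0 := fun i h1 h2 =>
    Finsupp.notMem_support_iff.1 fun hi => by rcases hle i hi with h | h <;> contradiction
  have h1 : (α 1 = 2 ∧ α 2 = 0) ∨ (α 1 = 0 ∧ α 2 = 1) := by omega
  rcases h1 with ⟨h1, h2⟩ | ⟨h1, h2⟩
  · left; ext i
    by_cases hi1 : i = 1
    · simp [hi1, h1]
    by_cases hi2 : i = 2
    · simp [hi2, h2]
    · rw [hz i hi1 hi2, Finsupp.single_eq_of_ne hi1]
  · right; ext i
    by_cases hi1 : i = 1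
    · simp [hi1, h1, hne]
    by_cases hi2 : i = 2
    · simp [hi2, h2]
    · rw [hz i hi1 hi2, Finsupp.single_eq_of_ne hi2]

lemma coeff_q_one_sq (α : ℕ+ →₀ ℕ) :
    MvPowerSeries.coeff α ((1 / 2 : ℚ) • q 1 ^ 2) = if wt α = 2 then (expCoeff α).coeff 2 else 0 := by
  rw [map_smul, q, MvPowerSeries.coeff_X_pow, smul_eq_mul]
  have hw : wt (Finsupp.single 1 2) = 2 := by simp
  split_ifs with h1 h2 h2
  · rw [h1]
    simp [expCoeff, varPoly_one, coeff_X_pow]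
  · rw [h1] at h2; exact absurd hw h2
  · rcases wt_eq_two h2 with h | h
    · exact absurd h h1
    · rw [h]
      simp [expCoeff, coeff_varPoly]
  · simp

theorem string_equation (hb : bracket = gjv) :
    del 1 F = Lambda1 F + (1 / 2 : ℚ) • q 1 ^ 2 := by
  ext α
  rw [map_add, coeff_q_one_sq, coeff_Lambda1]
  rcases Nat.even_or_odd (wt α) with h | h
  · obtain ⟨r, hr⟩ := h
    have hF : ∀ β, wt β + 1 = wt α →
        MvPowerSeries.coeff β F = (r - 2)! * (expCoeff β).coeff (r + 1) := fun β hβ => by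
      rw [coeff_F hb (p := r + 1) (by omega)]
      congr 3
    rw [Finset.sum_congr rfl fun i _ => coeff_Lambda1Term F α i _ _ hF, ← Finset.mul_sum,
      ← finsetSum_coeff, ← eulerCoeff_eq α (Finset.Subset.refl _), coeff_eulerCoeff,
      coeff_del_one_F hb (p := r + 1) (by omega), hr]
    -- In weight `2r` the Euler factor is `2r - (r + 1) = r - 1`, which turns `(r-2)!` into `(r-1)!`
    -- for `r ≥ 2`. For `r = 1` it is zero, and `∂F/∂q_1` contributes the term `q_1²/2`.
    rcases Nat.lt_or_ge r 2 with h2 | h2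
    · interval_cases r
      · rw [if_neg (by omega)]
        have : (expCoeff α).coeff 1 = 0 := by
          by_contra hne
          obtain ⟨g, hg⟩ := exists_of_coeff_expCoeff_ne_zero hne
          have := totDeg_mapDomain α
          omega
        simp [this]
      · simp
    · obtain ⟨t, rfl⟩ := Nat.exists_eq_add_of_le h2
      rw [if_neg (by omega), show 2 + t + 1 - 2 = t + 1 by omega, Nat.add_sub_cancel_left,
        Nat.factorial_succ]
      push_cast; ring
  · have hF : ∀ β, wt β + 1 = wt α →
        MvPowerSeries.coeff β F = 0 * (expCoeff β).coeff 0 := fun β hβ => by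
      rw [coeff_F_of_even hb, zero_mul]
      obtain ⟨r, hr⟩ := h
      exact ⟨r, by omega⟩
    rw [Finset.sum_congr rfl fun i _ => coeff_Lambda1Term F α i _ _ hF,
      coeff_del_one_F_of_odd hb h, if_neg]
    · simp
    · rintro h2
      rw [h2] at h
      exact absurd h (by decide)

end

/-! ### The explicit numbers satisfy the polynomial formula; uniqueness -/

section

open Polynomial Finset

lemma bracketPoly_expVec {n : ℕ} (d : Fin n → ℕ) :
    bracketPoly (expVec d) = ∏ i, C (1 / ((d i)! : ℚ)) * varPoly (d i + 1) := by
  rw [bracketPoly, expVec, ← Finsupp.prod_finsetSum_index (by simp) (fun _ _ _ => pow_add _ _ _)]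
  simp

lemma numPts_expVec {n : ℕ} (d : Fin n → ℕ) : numPts (expVec d) = n := by
  rw [numPts, expVec, ← Finsupp.sum_finsetSum_index (by simp) (by simp)]
  simp

lemma totDeg_expVec {n : ℕ} (d : Fin n → ℕ) : totDeg (expVec d) = ∑ i, d i := by
  rw [totDeg, expVec, ← Finsupp.sum_finsetSum_index (by simp) (fun _ _ _ => mul_add _ _ _)]
  simp

lemma exists_expVec_eq (k : ℕ →₀ ℕ) : ∃ d : Fin (numPts k) → ℕ, expVec d = k := by
  suffices h : ∀ m : Multiset ℕ, ∃ (n : ℕ) (d : Fin n → ℕ), expVec d = Multiset.toFinsupp m by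
    obtain ⟨n, d, hd⟩ := h (Finsupp.toMultiset k)
    rw [Finsupp.toMultiset_toFinsupp] at hd
    have hn : numPts k = n := by rw [← hd, numPts_expVec]
    subst hn
    exact ⟨d, hd⟩
  intro m
  induction m using Multiset.induction with
  | empty => exact ⟨0, Fin.elim0, by simp [expVec]⟩
  | cons a m ih =>
    obtain ⟨n, d, hd⟩ := ih
    refine ⟨n + 1, Fin.cons a d, ?_⟩
    rw [← Multiset.singleton_add, map_add, Multiset.toFinsupp_singleton, ← hd, expVec,
      Fin.sum_univ_succ]
    simp [expVec]

lemma sum_piAntidiag_eq_coeff_prod {R : Type*} [CommSemiring R] {n : ℕ}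
    (f : Fin n → PowerSeries R) (D : ℕ) :
    ∑ d ∈ piAntidiag univ D, ∏ i, PowerSeries.coeff (d i) (f i) =
      PowerSeries.coeff D (∏ i, f i) := by
  rw [PowerSeries.coeff_prod]
  refine Finset.sum_nbij' Finsupp.equivFunOnFinite.symm Finsupp.equivFunOnFinite ?_ ?_ ?_ ?_ ?_
  · intro d hd
    rw [mem_piAntidiag] at hd
    rw [mem_finsuppAntidiag]
    exact ⟨hd.1, Finset.subset_univ _⟩
  · intro d hd
    rw [mem_finsuppAntidiag] at hd
    rw [mem_piAntidiag]
    exact ⟨hd.1, by simp⟩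
  all_goals simp

lemma prod_rescale_exp {A : Type*} [CommRing A] [Algebra ℚ A] {ι : Type*} (s : Finset ι)
    (x : ι → A) : ∏ i ∈ s, PowerSeries.rescale (x i) (PowerSeries.exp A) =
      PowerSeries.rescale (∑ i ∈ s, x i) (PowerSeries.exp A) := by
  classical
  induction s using Finset.induction_on with
  | empty => simp
  | insert a s ha ih =>
    rw [Finset.prod_insert ha, Finset.sum_insert ha, ih, PowerSeries.exp_mul_exp_eq_exp_add]

/-- The generating series of the polynomials `b ^ d * varPoly (d + 1) / d!`. -/
def pointSeries (b : ℕ) : PowerSeries ℚ[X] :=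
  PowerSeries.mk fun d => C ((b : ℚ) ^ d) * (C (1 / (d ! : ℚ)) * varPoly (d + 1))

lemma pointSeries_eq (b : ℕ) : pointSeries b = PowerSeries.C X *
    (PowerSeries.rescale (C (b : ℚ)) (PowerSeries.exp ℚ[X]) *
      PowerSeries.rescale X (PowerSeries.map C (PowerSeries.rescale (b : ℚ) sinhc))) := by
  refine PowerSeries.ext fun d => ?_
  rw [PowerSeries.coeff_C_mul, PowerSeries.coeff_mul, pointSeries, PowerSeries.coeff_mk,
    varPoly_div_factorial, mul_left_comm, Finset.mul_sum]
  refine congrArg (fun t => X * t) ?_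
  refine Finset.sum_congr rfl fun p hp => ?_
  simp only [PowerSeries.coeff_rescale, PowerSeries.coeff_map, PowerSeries.coeff_exp,
    ← HasAntidiagonal.mem_antidiagonal.1 hp, pow_add, C_mul, Polynomial.algebraMap_eq, C_pow]
  ring

/-- By `pointSeries_eq` the generating series over the exponents `d_i` factors over the points as
`z^n e^{td} ∏ S(b_i z t)`, where `d = ∑ b_i`. Taking `z^(p+n)` picks degree `p` in the sinh factors,
and the remaining `D - p` powers of `t` come from the exponential. -/
lemma sum_coeff_bracketPoly {n : ℕ} (b : Fin n → ℕ) {D p : ℕ} (hp : p ≤ D) :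
    ∑ d ∈ piAntidiag univ D, (bracketPoly (expVec d)).coeff (p + n) * ∏ i, (b i : ℚ) ^ d i =
      (degree b : ℚ) ^ (D - p) / ((D - p)! : ℚ) *
        PowerSeries.coeff p (∏ i, PowerSeries.rescale (b i : ℚ) sinhc) := by
  have h1 : ∑ d ∈ piAntidiag (univ : Finset (Fin n)) D,
      (C (∏ i, (b i : ℚ) ^ d i) * bracketPoly (expVec d)) =
        PowerSeries.coeff D (∏ i, pointSeries (b i)) := by
    rw [← sum_piAntidiag_eq_coeff_prod]
    refine Finset.sum_congr rfl fun d _ => ?_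
    simp only [pointSeries, PowerSeries.coeff_mk]
    rw [Finset.prod_mul_distrib, bracketPoly_expVec, map_prod]
  have h2 : ∏ i, pointSeries (b i) = PowerSeries.C (X ^ n) *
      (PowerSeries.rescale (C (degree b : ℚ)) (PowerSeries.exp ℚ[X]) *
        PowerSeries.rescale X (PowerSeries.map C
          (∏ i, PowerSeries.rescale (b i : ℚ) sinhc))) := by
    simp only [pointSeries_eq, Finset.prod_mul_distrib, prod_rescale_exp, Finset.prod_const,
      Finset.card_univ, Fintype.card_fin, map_pow, map_prod, degree, Nat.cast_sum, map_sum]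
  have h3 := congrArg (fun t => t.coeff (p + n)) h1
  simp only [finsetSum_coeff, coeff_C_mul] at h3
  rw [h2, PowerSeries.coeff_C_mul, coeff_X_pow_mul, PowerSeries.coeff_mul, finsetSum_coeff,
    Finset.sum_eq_single (D - p, p)] at h3
  · rw [Finset.sum_congr rfl fun d _ => mul_comm _ _, h3]
    simp only [PowerSeries.coeff_rescale, PowerSeries.coeff_map, PowerSeries.coeff_exp,
      Polynomial.algebraMap_eq]
    rw [← C_pow, ← C_mul, coeff_C_mul, mul_comm (X ^ p), coeff_C_mul, coeff_X_pow, if_pos rfl]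
    ring
  · rintro ⟨k, l⟩ hkl hne
    rw [HasAntidiagonal.mem_antidiagonal] at hkl
    simp only [PowerSeries.coeff_rescale, PowerSeries.coeff_map, PowerSeries.coeff_exp,
      Polynomial.algebraMap_eq]
    rw [← C_pow, ← C_mul, coeff_C_mul, mul_comm (X ^ l), coeff_C_mul, coeff_X_pow, if_neg]
    · simp
    · rintro rfl
      apply hne
      dsimp only at hkl
      rw [Prod.mk.injEq]; omega
  · intro h
    exact absurd (HasAntidiagonal.mem_antidiagonal.2 (by dsimp only; omega)) h

/-- The product is invariant under `u ↦ -u`. -/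
lemma coeff_prod_rescale_sinhc_of_odd {n : ℕ} (b : Fin n → ℕ) {p : ℕ} (hp : Odd p) :
    PowerSeries.coeff p (∏ i, PowerSeries.rescale (b i : ℚ) sinhc) = 0 := by
  have h1 : PowerSeries.rescale (-1 : ℚ) (∏ i, PowerSeries.rescale (b i : ℚ) sinhc) =
      ∏ i, PowerSeries.rescale (b i : ℚ) sinhc := by
    rw [map_prod]
    refine Finset.prod_congr rfl fun i _ => ?_
    ext k
    simp only [PowerSeries.coeff_rescale, coeff_sinhc]
    split_ifs with h
    · rw [h.neg_one_pow, one_mul]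
    · simp
  have h2 := congrArg (PowerSeries.coeff p) h1
  rw [PowerSeries.coeff_rescale, hp.neg_one_pow] at h2
  linarith

/-- The generating function of one-part double Hurwitz numbers, in a normalized form. -/
def hurwitzSeries {ι : Type*} [Fintype ι] (b : ι → ℕ) : PowerSeries ℚ :=
  sinhc⁻¹ * ∏ i, PowerSeries.rescale (b i : ℚ) sinhc

lemma coeff_hurwitzSeries {n : ℕ} (b : Fin n → ℕ) (g : ℕ) :
    PowerSeries.coeff (2 * g) (hurwitzSeries b) = ∑ j ∈ range (g + 1),
      PowerSeries.coeff (2 * j) sinhc⁻¹ *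
        PowerSeries.coeff (2 * (g - j)) (∏ i, PowerSeries.rescale (b i : ℚ) sinhc) := by
  rw [hurwitzSeries, PowerSeries.coeff_mul]
  symm
  refine Finset.sum_bij_ne_zero (fun j _ _ => (2 * j, 2 * (g - j))) ?_ ?_ ?_ ?_
  · intro j hj _
    have := Finset.mem_range.1 hj
    rw [HasAntidiagonal.mem_antidiagonal]
    dsimp only; omega
  · intro j _ _ j' _ _ h
    rw [Prod.mk.injEq] at h; omega
  · rintro ⟨k, l⟩ hkl h0
    rw [HasAntidiagonal.mem_antidiagonal] at hkl
    dsimp only at hkl h0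
    have hl : Even l := by
      by_contra hl
      rw [coeff_prod_rescale_sinhc_of_odd b (Nat.not_even_iff_odd.1 hl), mul_zero] at h0
      exact h0 rfl
    obtain ⟨r, hr⟩ := hl
    have h1 : 2 * (g - r) = k := by omega
    have h2 : 2 * (g - (g - r)) = l := by omega
    exact ⟨g - r, Finset.mem_range.2 (by omega), by rwa [h1, h2], by rw [h1, h2]⟩
  · intro j _ _
    rfl

theorem gjv_formula (g n : ℕ) (hn : 1 ≤ n) (hg : g = 0 → 3 ≤ n) (b : Fin n → ℕ) :
    ∑ j ∈ range (g + 1), (-1 : ℚ) ^ j *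
        ∑ d ∈ piAntidiag (univ : Finset (Fin n)) (4 * g + n - 3 - 2 * j),
          gjv j (expVec d) * ∏ i, (b i : ℚ) ^ d i =
      (degree b : ℚ) ^ (2 * g + n - 3) * PowerSeries.coeff (2 * g) (hurwitzSeries b) := by
  rw [coeff_hurwitzSeries, Finset.mul_sum]
  refine Finset.sum_congr rfl fun j hj => ?_
  have hj' : j ≤ g := by have := Finset.mem_range.1 hj; omega
  have hdim : 3 + 2 * j ≤ 4 * g + n := by
    rcases Nat.eq_zero_or_pos g with h0 | h0
    · have := hg h0; omega
    · omega
  have h1 : ∀ d ∈ piAntidiag (univ : Finset (Fin n)) (4 * g + n - 3 - 2 * j),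
      gjv j (expVec d) * ∏ i, (b i : ℚ) ^ d i =
        ((-1) ^ j * PowerSeries.coeff (2 * j) sinhc⁻¹ * (2 * g + n - 3)!) *
          ((bracketPoly (expVec d)).coeff (2 * (g - j) + n) * ∏ i, (b i : ℚ) ^ d i) := by
    intro d hd
    have h : totDeg (expVec d) = 4 * g + n - 3 - 2 * j :=
      (totDeg_expVec d).trans (mem_piAntidiag.1 hd).1
    have h' : 4 * g + numPts (expVec d) = 2 * j + totDeg (expVec d) + 3 := by
      rw [numPts_expVec, h]; omega
    rw [gjv_eq hj' h', numPts_expVec]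
    ring
  -- The exponent of the degree does not depend on `j`, so it factors out and the sum over `j` is
  -- the Cauchy product of `1/S` with `∏ S(b_i u)`. The factorial in `gjv` cancels its denominator.
  have h2 : 4 * g + n - 3 - 2 * j - 2 * (g - j) = 2 * g + n - 3 := by omega
  have h3 : ((2 * g + n - 3)! : ℚ) ≠ 0 := by positivity
  have h4 : ((-1 : ℚ) ^ j) * (-1) ^ j = 1 := by rw [← mul_pow]; simp
  rw [Finset.sum_congr rfl h1, ← Finset.mul_sum, sum_coeff_bracketPoly b (by omega), h2]
  field_simp
  linear_combination (PowerSeries.coeff (2 * j) sinhc⁻¹ * (degree b : ℚ) ^ (2 * g + n - 3) *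
    PowerSeries.coeff (2 * (g - j)) (∏ i, PowerSeries.rescale (b i : ℚ) sinhc)) * h4

/-- The polynomial in the `b i` given by the right hand side of the Goulden-Jackson-Vakil
formula. -/
def formulaPoly (N : ℕ → (ℕ →₀ ℕ) → ℚ) (g n : ℕ) : MvPolynomial (Fin n) ℚ :=
  ∑ j ∈ range (g + 1), ∑ d ∈ piAntidiag (univ : Finset (Fin n)) (4 * g + n - 3 - 2 * j),
    MvPolynomial.monomial (Finsupp.equivFunOnFinite.symm d) ((-1 : ℚ) ^ j * N j (expVec d))

lemma eval_formulaPoly (N : ℕ → (ℕ →₀ ℕ) → ℚ) (g n : ℕ) (x : Fin n → ℚ) :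
    MvPolynomial.eval x (formulaPoly N g n) = ∑ j ∈ range (g + 1), (-1 : ℚ) ^ j *
        ∑ d ∈ piAntidiag (univ : Finset (Fin n)) (4 * g + n - 3 - 2 * j),
          N j (expVec d) * ∏ i, x i ^ d i := by
  simp only [formulaPoly, map_sum, MvPolynomial.eval_monomial, Finset.mul_sum]
  refine Finset.sum_congr rfl fun j _ => Finset.sum_congr rfl fun d _ => ?_
  rw [Finsupp.prod_fintype _ _ (by simp), mul_assoc]
  rfl

/-- Different `j` occur in different total degrees, so each monomial receives exactly one bracket.
-/
lemma coeff_formulaPoly (N : ℕ → (ℕ →₀ ℕ) → ℚ) {g n j : ℕ} (hj : j ≤ g) (d : Fin n → ℕ)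
    (h : 4 * g + n = 2 * j + ∑ i, d i + 3) :
    MvPolynomial.coeff (Finsupp.equivFunOnFinite.symm d) (formulaPoly N g n) =
      (-1 : ℚ) ^ j * N j (expVec d) := by
  simp only [formulaPoly, MvPolynomial.coeff_sum, MvPolynomial.coeff_monomial,
    EmbeddingLike.apply_eq_iff_eq]
  rw [Finset.sum_eq_single j, Finset.sum_eq_single d]
  · simp
  · intro d' _ hne
    rw [if_neg hne]
  · intro hd
    have hs : ∑ i, d i = 4 * g + n - 3 - 2 * j := by omega
    exact absurd (mem_piAntidiag.2 ⟨hs, by simp⟩) hd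
  · intro j' hj' hne
    refine Finset.sum_eq_zero fun d' hd' => if_neg ?_
    rintro rfl
    have h1 : ∑ i, d' i = _ := (mem_piAntidiag.1 hd').1
    have := Finset.mem_range.1 hj'
    omega
  · intro h'
    exact absurd (Finset.mem_range.2 (by omega)) h'

theorem IsGJVSystem.unique {N N' : ℕ → (ℕ →₀ ℕ) → ℚ} (hN : IsGJVSystem N)
    (hN' : IsGJVSystem N') : N = N' := by
  funext j k
  by_cases hk : ∃ g, j ≤ g ∧ 4 * g + k.sum (fun _ e => e) = 2 * j + k.sum (fun i e => i * e) + 3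
  · obtain ⟨g, hj, hg⟩ := hk
    change 4 * g + numPts k = 2 * j + totDeg k + 3 at hg
    obtain ⟨d, hd⟩ := exists_expVec_eq k
    generalize hn : numPts k = n at d hg hd
    have hs : totDeg k = ∑ i, d i := by rw [← hd, totDeg_expVec]
    -- For `n = 0` the constraint would read `4g = 2j + 3`, impossible by parity.
    have hn1 : 1 ≤ n := by
      rcases Nat.eq_zero_or_pos n with rfl | h
      · simp at hs; omega
      · exact h
    have hp : formulaPoly N g n = formulaPoly N' g n := by
      -- The two polynomials agree on all tuples of positive integers, a product of infinite sets.
      refine MvPolynomial.funext_set (fun _ => Set.range fun m : ℕ => ((m + 1 : ℕ) : ℚ))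
        (fun _ => Set.infinite_range_of_injective fun a b h => ?_) fun x hx => ?_
      · simpa using h
      · choose b hb using fun i => hx i (Set.mem_univ i)
        obtain rfl : (fun i => ((b i + 1 : ℕ) : ℚ)) = x := funext hb
        rw [eval_formulaPoly, eval_formulaPoly,
          ← hN.formula g n hn1 (by omega) (fun i => b i + 1) (fun i => by omega),
          ← hN'.formula g n hn1 (by omega) (fun i => b i + 1) (fun i => by omega)]
    have h := congrArg (MvPolynomial.coeff (Finsupp.equivFunOnFinite.symm d)) hp
    rw [coeff_formulaPoly N hj d (by omega), coeff_formulaPoly N' hj d (by omega), hd] at h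
    exact mul_left_cancel₀ (pow_ne_zero j (by norm_num)) h
  · rw [hN.dimension j k hk, hN'.dimension j k hk]

end

/-! ### Hyperbolic sines solve the cut-and-join equation -/

section

open Finset

/-- The power series `exp (d s / 2)`. -/
def expUp (d : ℕ) : PowerSeries ℚ := PowerSeries.rescale ((d : ℚ) / 2) (PowerSeries.exp ℚ)

/-- The power series `exp (-d s / 2)`. -/
def expDown (d : ℕ) : PowerSeries ℚ := PowerSeries.rescale (-((d : ℚ) / 2)) (PowerSeries.exp ℚ)

/-- The power series `2 sinh (b d s / 2)`. -/
def expDiff (d b : ℕ) : PowerSeries ℚ := expUp d ^ b - expDown d ^ b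

/-- The power series `2 cosh (b d s / 2)`. -/
def expSum (d b : ℕ) : PowerSeries ℚ := expUp d ^ b + expDown d ^ b

lemma derivative_rescale_exp (c : ℚ) :
    PowerSeries.derivative ℚ (PowerSeries.rescale c (PowerSeries.exp ℚ)) =
      PowerSeries.C c * PowerSeries.rescale c (PowerSeries.exp ℚ) := by
  ext n
  rw [PowerSeries.coeff_derivative, PowerSeries.coeff_C_mul, PowerSeries.coeff_rescale,
    PowerSeries.coeff_rescale, PowerSeries.coeff_exp, PowerSeries.coeff_exp, Nat.factorial_succ]
  simp only [Algebra.algebraMap_self, RingHom.id_apply]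
  push_cast
  field_simp
  ring

lemma derivative_pow_rescale_exp (c : ℚ) (n : ℕ) :
    PowerSeries.derivative ℚ (PowerSeries.rescale c (PowerSeries.exp ℚ) ^ n) =
      PowerSeries.C (n * c) * PowerSeries.rescale c (PowerSeries.exp ℚ) ^ n := by
  rw [Derivation.leibniz_pow, derivative_rescale_exp]
  cases n with
  | zero => simp
  | succ n =>
    rw [Nat.add_sub_cancel, pow_succ, smul_eq_mul, nsmul_eq_mul, map_mul, map_natCast]
    ring

lemma derivative_expDiff (d b : ℕ) : PowerSeries.derivative ℚ (expDiff d b) =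
    PowerSeries.C ((d : ℚ) / 2 * b) * expSum d b := by
  rw [expDiff, expSum, map_sub, expUp, expDown, derivative_pow_rescale_exp,
    derivative_pow_rescale_exp, mul_neg, map_neg, mul_comm ((d : ℚ) / 2)]
  ring

lemma derivative_prod {ι : Type*} [DecidableEq ι] (s : Finset ι) (f : ι → PowerSeries ℚ) :
    PowerSeries.derivative ℚ (∏ i ∈ s, f i) =
      ∑ i ∈ s, (∏ j ∈ s.erase i, f j) * PowerSeries.derivative ℚ (f i) := by
  induction s using Finset.induction_on with
  | empty => simp
  | insert a s ha ih =>
    rw [Finset.prod_insert ha, Finset.sum_insert ha, Derivation.leibniz, ih, Finset.erase_insert ha,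
      smul_eq_mul, smul_eq_mul, Finset.mul_sum, add_comm]
    congr 1
    refine Finset.sum_congr rfl fun i hi => ?_
    have hne : a ≠ i := by rintro rfl; exact ha hi
    rw [Finset.erase_insert_of_ne hne, Finset.prod_insert (fun h => ha (Finset.mem_of_mem_erase h)),
      mul_assoc]

lemma natCast_powerSeries_ne_zero {n : ℕ} (hn : n ≠ 0) : (n : PowerSeries ℚ) ≠ 0 := by
  rw [← map_natCast (PowerSeries.C (R := ℚ)), Ne, map_eq_zero_iff _ PowerSeries.C_injective]
  exact_mod_cast hn

lemma rescale_exp_sub_rescale_exp :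
    PowerSeries.rescale (1 / 2 : ℚ) (PowerSeries.exp ℚ) -
      PowerSeries.rescale (-(1 / 2) : ℚ) (PowerSeries.exp ℚ) = PowerSeries.X * sinhc := by
  ext n
  rw [map_sub, PowerSeries.coeff_rescale, PowerSeries.coeff_rescale, PowerSeries.coeff_exp]
  cases n with
  | zero => simp
  | succ n =>
    rw [PowerSeries.coeff_succ_X_mul, coeff_sinhc]
    simp only [Algebra.algebraMap_self, RingHom.id_apply]
    split_ifs with h
    · rw [(Even.add_one h).neg_pow, one_div_pow, pow_succ]
      field_simp
      ring
    · rw [(Odd.add_one (Nat.not_even_iff_odd.1 h)).neg_pow, sub_self]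

lemma expDiff_eq (d b : ℕ) : expDiff d b =
    PowerSeries.C ((d : ℚ) * b) * PowerSeries.X *
      PowerSeries.rescale (d : ℚ) (PowerSeries.rescale (b : ℚ) sinhc) := by
  have h1 : ∀ c : ℚ, PowerSeries.rescale c (PowerSeries.exp ℚ) ^ b =
      PowerSeries.rescale (b * c) (PowerSeries.exp ℚ) := fun c => by
    rw [← map_pow, PowerSeries.exp_pow_eq_rescale_exp, PowerSeries.rescale_rescale]
  have h2 := congrArg (PowerSeries.rescale ((b : ℚ) * d)) rescale_exp_sub_rescale_exp
  rw [map_sub, PowerSeries.rescale_rescale, PowerSeries.rescale_rescale, map_mul,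
    PowerSeries.rescale_X] at h2
  rw [expDiff, expUp, expDown, h1, h1, PowerSeries.rescale_rescale]
  convert h2 using 3
  · congr 1; ring
  · congr 1; ring
  · rw [mul_comm]

variable {ι : Type*} [Fintype ι]

/-- The exponential generating series, in the number of transpositions, of the factorizations of a
permutation of degree `d` with cycle lengths `b i`. -/
def countSeries (d : ℕ) (b : ι → ℕ) : PowerSeries ℚ :=
  PowerSeries.C ((∏ i, (b i : ℚ)) / d) *
    ((PowerSeries.C (d : ℚ) * PowerSeries.X) ^ (Fintype.card ι - 1) *
      PowerSeries.rescale (d : ℚ) (hurwitzSeries b))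

/-- The closed form of `countSeries` with the denominator cleared, so that the cut-and-join equation
can be checked by ring identities. -/
lemma expDiff_one_mul_countSeries [Nonempty ι] {d : ℕ} (hd : d ≠ 0) (b : ι → ℕ) :
    PowerSeries.C (d : ℚ) * (expDiff d 1 * countSeries d b) = ∏ i, expDiff d (b i) := by
  have h1 : ∀ i, expDiff d (b i) = PowerSeries.C (b i : ℚ) * ((PowerSeries.C (d : ℚ) *
      PowerSeries.X) * PowerSeries.rescale (d : ℚ) (PowerSeries.rescale (b i : ℚ) sinhc)) :=
    fun i => by rw [expDiff_eq, map_mul]; ring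
  have h2 : expDiff d 1 = PowerSeries.C (d : ℚ) * PowerSeries.X *
      PowerSeries.rescale (d : ℚ) sinhc := by
    rw [expDiff_eq]; simp
  have h3 : PowerSeries.rescale (d : ℚ) sinhc * PowerSeries.rescale (d : ℚ) sinhc⁻¹ = 1 := by
    rw [← map_mul, PowerSeries.mul_inv_cancel _ (by rw [constantCoeff_sinhc]; simp), map_one]
  have h4 : PowerSeries.C (d : ℚ) * PowerSeries.C ((∏ i, (b i : ℚ)) / d) =
      ∏ i, PowerSeries.C (b i : ℚ) := by
    rw [← map_mul, ← map_prod, mul_div_cancel₀]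
    exact_mod_cast hd
  have h5 : (PowerSeries.C (d : ℚ) * PowerSeries.X) ^ Fintype.card ι =
      (PowerSeries.C (d : ℚ) * PowerSeries.X) * (PowerSeries.C (d : ℚ) * PowerSeries.X) ^
        (Fintype.card ι - 1) := by
    rw [← pow_succ', Nat.sub_add_cancel Fintype.card_pos]
  simp only [h1, Finset.prod_mul_distrib, Finset.prod_const, Finset.card_univ]
  rw [← mul_pow, h5, h2, countSeries, hurwitzSeries, map_mul, map_prod, ← h4]
  linear_combination (PowerSeries.C (d : ℚ) * PowerSeries.C ((∏ i, (b i : ℚ)) / d) *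
    (PowerSeries.C (d : ℚ) * PowerSeries.X) * (PowerSeries.C (d : ℚ) * PowerSeries.X) ^
        (Fintype.card ι - 1) *
    ∏ i, PowerSeries.rescale (d : ℚ) (PowerSeries.rescale (b i : ℚ) sinhc)) * h3

lemma expDiff_one_ne_zero {d : ℕ} (hd : d ≠ 0) : expDiff d 1 ≠ 0 := by
  have hd' : (d : ℚ) ≠ 0 := by exact_mod_cast hd
  intro h
  have h2 : expDiff d 1 = PowerSeries.C (d : ℚ) * (PowerSeries.X *
      PowerSeries.rescale (d : ℚ) sinhc) := by
    rw [expDiff_eq]; simp [mul_assoc]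
  have h3 := congrArg (PowerSeries.coeff 1) h
  rw [h2, PowerSeries.coeff_C_mul, show 1 = 0 + 1 from rfl, PowerSeries.coeff_succ_X_mul,
    PowerSeries.coeff_rescale, coeff_sinhc] at h3
  simp [hd] at h3

variable [DecidableEq ι]

/-- The lengths of cycles after joining the cycles `i` and `j`. -/
def joinLen (b : ι → ℕ) (i j : ι) (l : {l : ι // l ≠ j}) : ℕ :=
  if (l : ι) = i then b i + b j else b l

/-- The lengths of cycles after cutting a cycle of length `k` from the cycle `i`. -/
def cutLen (b : ι → ℕ) (i : ι) (k : ℕ) (o : Option ι) : ℕ :=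
  o.elim k (Function.update b i (b i - k))

lemma prod_joinLen {R : Type*} [CommMonoid R] (f : ℕ → R) (b : ι → ℕ) {i j : ι} (h : i ≠ j) :
    ∏ l, f (joinLen b i j l) = f (b i + b j) * ∏ l ∈ (univ.erase i).erase j, f (b l) := by
  have h1 : ∏ l, f (joinLen b i j l) =
      ∏ l ∈ univ.erase j, f (if l = i then b i + b j else b l) :=
    (Finset.prod_subtype (univ.erase j) (by simp)
      (fun l => f (if l = i then b i + b j else b l))).symm
  rw [h1, ← Finset.mul_prod_erase (univ.erase j) _ (Finset.mem_erase.2 ⟨h, Finset.mem_univ i⟩),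
    if_pos rfl, Finset.erase_right_comm]
  congr 1
  refine Finset.prod_congr rfl fun l hl => ?_
  rw [if_neg (Finset.ne_of_mem_erase (Finset.mem_of_mem_erase hl))]

lemma prod_cutLen {R : Type*} [CommMonoid R] (f : ℕ → R) (b : ι → ℕ) (i : ι) (k : ℕ) :
    ∏ o, f (cutLen b i k o) = f k * f (b i - k) * ∏ l ∈ univ.erase i, f (b l) := by
  rw [Fintype.prod_option, mul_assoc]
  congr 1
  rw [← Finset.mul_prod_erase univ _ (Finset.mem_univ i)]
  congr 1
  · simp [cutLen]
  · refine Finset.prod_congr rfl fun l hl => ?_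
    simp [cutLen, Function.update_of_ne (Finset.ne_of_mem_erase hl)]

lemma two_mul_expDiff_add (d m n : ℕ) :
    2 * expDiff d (m + n) = expDiff d m * expSum d n + expSum d m * expDiff d n := by
  simp only [expDiff, expSum, pow_add]; ring

/-- An instance of `sub_mul_sum_antidiagonal`; the end terms `k = 0` and `k = n` vanish. -/
lemma expDiff_one_mul_sum (d n : ℕ) :
    expDiff d 1 * ∑ k ∈ Ico 1 n, expDiff d k * expDiff d (n - k) =
      (n : PowerSeries ℚ) * (expDiff d 1 * expSum d n) - expSum d 1 * expDiff d n := by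
  have h := sub_mul_sum_antidiagonal (expUp d) (expDown d) n
  rw [Finset.Nat.sum_antidiagonal_eq_sum_range_succ
    (fun i j => (expUp d ^ i - expDown d ^ i) * (expUp d ^ j - expDown d ^ j))] at h
  simp only [expDiff, expSum, pow_one]
  rw [← h]
  congr 1
  refine Finset.sum_subset (fun k hk => ?_) fun k hk hk' => ?_
  · rw [Finset.mem_Ico] at hk
    exact Finset.mem_range.2 (by omega)
  · rw [Finset.mem_range] at hk
    rw [Finset.mem_Ico] at hk'
    have : k = 0 ∨ n - k = 0 := by omega
    rcases this with h | h <;> simp [h]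

lemma sum_sum_erase_symm (b : ι → PowerSeries ℚ) (f : ι → PowerSeries ℚ) :
    ∑ i, ∑ j ∈ univ.erase i, b i * b j * (f i + f j) =
      2 * ∑ i, b i * ((∑ j, b j) - b i) * f i := by
  have h1 : ∑ i, ∑ j ∈ univ.erase i, b i * b j * f i = ∑ i, b i * ((∑ j, b j) - b i) * f i := by
    refine Finset.sum_congr rfl fun i _ => ?_
    rw [← Finset.sum_erase_eq_sub (Finset.mem_univ i), Finset.mul_sum, Finset.sum_mul]
  have h2 : ∑ i, ∑ j ∈ univ.erase i, b i * b j * f j = ∑ i, ∑ j ∈ univ.erase i, b i * b j * f i := by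
    rw [Finset.sum_comm' (t' := univ) (s' := fun i => univ.erase i)]
    · refine Finset.sum_congr rfl fun i _ => Finset.sum_congr rfl fun j _ => ?_
      ring
    · simp [eq_comm]
  simp only [mul_add, Finset.sum_add_distrib]
  rw [h2, h1]; ring

/-- The cut-and-join equation. -/
theorem derivative_countSeries [Nonempty ι] {d : ℕ} (hd : d ≠ 0) (b : ι → ℕ)
    (hb : ∑ i, b i = d) :
    2 * PowerSeries.derivative ℚ (countSeries d b) =
      ∑ i, ∑ j ∈ univ.erase i, (b i : PowerSeries ℚ) * b j * countSeries d (joinLen b i j) +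
      ∑ i, (b i : PowerSeries ℚ) * ∑ k ∈ Ico 1 (b i), countSeries d (cutLen b i k) := by
  set P := ∏ i, expDiff d (b i) with hP
  set R : ι → PowerSeries ℚ := fun i => ∏ l ∈ univ.erase i, expDiff d (b l) with hR
  have hdC : PowerSeries.C (d : ℚ) = (d : PowerSeries ℚ) := map_natCast _ _
  have hER : ∀ i, expDiff d (b i) * R i = P := fun i =>
    Finset.mul_prod_erase univ (fun l => expDiff d (b l)) (Finset.mem_univ i)
  have hdP : 2 * PowerSeries.derivative ℚ P =
      (d : PowerSeries ℚ) * ∑ i, (b i : PowerSeries ℚ) * (expSum d (b i) * R i) := by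
    rw [hP, derivative_prod, Finset.mul_sum, Finset.mul_sum]
    refine Finset.sum_congr rfl fun i _ => ?_
    rw [derivative_expDiff]
    have : (2 : PowerSeries ℚ) * PowerSeries.C ((d : ℚ) / 2 * b i) =
        (d : PowerSeries ℚ) * (b i : PowerSeries ℚ) := by
      rw [show (2 : PowerSeries ℚ) = PowerSeries.C 2 from (map_ofNat _ 2).symm, ← map_mul,
        ← mul_assoc, mul_div_cancel₀ _ two_ne_zero, map_mul, map_natCast, map_natCast]
    linear_combination (R i * expSum d (b i)) * this
  have hdE : 2 * PowerSeries.derivative ℚ (expDiff d 1) = (d : PowerSeries ℚ) * expSum d 1 := by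
    rw [derivative_expDiff, Nat.cast_one, mul_one,
      show (2 : PowerSeries ℚ) = PowerSeries.C 2 from (map_ofNat _ 2).symm, ← mul_assoc, ← map_mul,
      mul_div_cancel₀ _ two_ne_zero, map_natCast]
  have hA := expDiff_one_mul_countSeries hd b
  -- With `P = ∏ 2 sinh(b_i d s/2)`, the cleared identity is differentiated instead of the quotient
  -- `P / (d · 2 sinh(ds/2))`.
  have hdA := congrArg (PowerSeries.derivative ℚ) hA
  rw [hdC, Derivation.leibniz, Derivation.leibniz, Derivation.map_natCast] at hdA
  simp only [smul_eq_mul, mul_zero, add_zero] at hdA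
  rw [← hP] at hA hdA
  rw [hdC] at hA
  -- The addition formula splits a join of cycles `i` and `j` into the terms of `i` and of `j`; the
  -- other lengths sum to `d - b i`.
  have hjoin : (d : PowerSeries ℚ) * expDiff d 1 * ∑ i, ∑ j ∈ univ.erase i,
        (b i : PowerSeries ℚ) * b j * countSeries d (joinLen b i j) =
      ∑ i, (b i : PowerSeries ℚ) * ((d : PowerSeries ℚ) - b i) * (expSum d (b i) * R i) := by
    have h2 : (2 : PowerSeries ℚ) ≠ 0 := by
      exact_mod_cast natCast_powerSeries_ne_zero two_ne_zero
    apply mul_left_cancel₀ h2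
    have h3 := sum_sum_erase_symm (fun i => (b i : PowerSeries ℚ)) fun i => expSum d (b i) * R i
    rw [← Nat.cast_sum, hb] at h3
    rw [← h3]
    simp only [Finset.mul_sum]
    refine Finset.sum_congr rfl fun i _ => Finset.sum_congr rfl fun j hj => ?_
    have hij : i ≠ j := (Finset.ne_of_mem_erase hj).symm
    have : Nonempty {l : ι // l ≠ j} := ⟨⟨i, hij⟩⟩
    have h4 := expDiff_one_mul_countSeries hd (joinLen b i j)
    rw [prod_joinLen _ _ hij, hdC] at h4
    have h5 : expDiff d (b j) * ∏ l ∈ (univ.erase i).erase j, expDiff d (b l) = R i :=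
      Finset.mul_prod_erase _ (fun l => expDiff d (b l)) (Finset.mem_erase.2 ⟨hij.symm, Finset.mem_univ j⟩)
    have h6 : expDiff d (b i) * ∏ l ∈ (univ.erase i).erase j, expDiff d (b l) = R j := by
      rw [Finset.erase_right_comm]
      exact Finset.mul_prod_erase _ (fun l => expDiff d (b l)) (Finset.mem_erase.2 ⟨hij, Finset.mem_univ i⟩)
    rw [← h5, ← h6]
    linear_combination 2 * (b i : PowerSeries ℚ) * b j * h4 + (b i : PowerSeries ℚ) * b j *
      (∏ l ∈ (univ.erase i).erase j, expDiff d (b l)) * two_mul_expDiff_add d (b i) (b j)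
  -- The convolution supplies the missing weights `b i * b i` and, via `∑ b_i = d`, the term with
  -- `expSum d 1` that comes from differentiating the denominator.
  have hcut : (d : PowerSeries ℚ) * expDiff d 1 * (expDiff d 1 * ∑ i, (b i : PowerSeries ℚ) *
        ∑ k ∈ Ico 1 (b i), countSeries d (cutLen b i k)) =
      expDiff d 1 * (∑ i, (b i : PowerSeries ℚ) * b i * (expSum d (b i) * R i)) -
        (d : PowerSeries ℚ) * (expSum d 1 * P) := by
    have h1 : (d : PowerSeries ℚ) = ∑ i, (b i : PowerSeries ℚ) := by
      rw [← hb, Nat.cast_sum]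
    conv_rhs => rw [h1, Finset.sum_mul, Finset.mul_sum, ← Finset.sum_sub_distrib]
    rw [Finset.mul_sum, Finset.mul_sum]
    refine Finset.sum_congr rfl fun i _ => ?_
    have h2 : (d : PowerSeries ℚ) * expDiff d 1 *
        ∑ k ∈ Ico 1 (b i), countSeries d (cutLen b i k) =
          (∑ k ∈ Ico 1 (b i), expDiff d k * expDiff d (b i - k)) * R i := by
      rw [Finset.mul_sum, Finset.sum_mul]
      refine Finset.sum_congr rfl fun k _ => ?_
      have h4 := expDiff_one_mul_countSeries hd (cutLen b i k)
      rw [prod_cutLen, hdC, ← mul_assoc] at h4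
      exact h4
    linear_combination (b i : PowerSeries ℚ) * expDiff d 1 * h2 +
      (b i : PowerSeries ℚ) * R i * expDiff_one_mul_sum d (b i) -
      (b i : PowerSeries ℚ) * expSum d 1 * hER i
  have hne : (d : PowerSeries ℚ) * expDiff d 1 * expDiff d 1 ≠ 0 := by
    have := expDiff_one_ne_zero hd
    have h0 : (d : PowerSeries ℚ) ≠ 0 := natCast_powerSeries_ne_zero hd
    exact mul_ne_zero (mul_ne_zero h0 this) this
  apply mul_left_cancel₀ hne
  have hsum : ∑ i, (b i : PowerSeries ℚ) * ((d : PowerSeries ℚ) - b i) * (expSum d (b i) * R i) +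
      ∑ i, (b i : PowerSeries ℚ) * b i * (expSum d (b i) * R i) =
        (d : PowerSeries ℚ) * ∑ i, (b i : PowerSeries ℚ) * (expSum d (b i) * R i) := by
    rw [← Finset.sum_add_distrib, Finset.mul_sum]
    refine Finset.sum_congr rfl fun i _ => ?_
    ring
  linear_combination 2 * expDiff d 1 * hdA - 2 * PowerSeries.derivative ℚ (expDiff d 1) * hA +
    expDiff d 1 * hdP - P * hdE - expDiff d 1 * hjoin - hcut - expDiff d 1 * hsum

end

/-! ### How a transposition joins or cuts labelled cycles -/

section

open Finset Equiv.Perm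

set_option linter.unusedSectionVars false

variable {V : Type*} [Fintype V] [DecidableEq V]

/-- The map `c` labels the cycles of the permutation `ρ`, and all labels are used. -/
structure IsLabelling {ι : Type*} (ρ : Equiv.Perm V) (c : V → ι) : Prop where
  eq_iff : ∀ x y, c x = c y ↔ ρ.SameCycle x y
  surjective : Function.Surjective c

/-- The number of elements with label `i`. -/
def fiberCard {ι : Type*} [DecidableEq ι] (c : V → ι) (i : ι) : ℕ := #{x | c x = i}

lemma minimalPeriod_pos (ρ : Equiv.Perm V) (x : V) : 0 < Function.minimalPeriod ρ x :=
  Function.minimalPeriod_pos_of_mem_periodicPts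
    (Function.Injective.mem_periodicPts ρ.injective x)

lemma pow_minimalPeriod_apply (ρ : Equiv.Perm V) (x : V) :
    (ρ ^ Function.minimalPeriod ρ x) x = x := by
  rw [← Equiv.Perm.iterate_eq_pow]; exact Function.isPeriodicPt_minimalPeriod ρ x

lemma sameCycle_iff_exists_lt (ρ : Equiv.Perm V) (x z : V) :
    ρ.SameCycle x z ↔ ∃ k < Function.minimalPeriod ρ x, (ρ ^ k) x = z := by
  constructor
  · intro h
    obtain ⟨k, -, hk⟩ := h.exists_pow_eq'
    refine ⟨k % Function.minimalPeriod ρ x, Nat.mod_lt _ (minimalPeriod_pos ρ x), ?_⟩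
    rw [← hk, ← Equiv.Perm.iterate_eq_pow, ← Equiv.Perm.iterate_eq_pow,
      Function.iterate_mod_minimalPeriod_eq]
  · rintro ⟨k, -, rfl⟩
    exact ⟨k, by simp⟩

lemma pow_injOn (ρ : Equiv.Perm V) (x : V) {k l : ℕ} (hk : k < Function.minimalPeriod ρ x)
    (hl : l < Function.minimalPeriod ρ x) (h : (ρ ^ k) x = (ρ ^ l) x) : k = l := by
  rw [← Equiv.Perm.iterate_eq_pow, ← Equiv.Perm.iterate_eq_pow] at h
  exact Function.iterate_injOn_Iio_minimalPeriod hk hl h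

lemma pow_apply_ne (ρ : Equiv.Perm V) (x : V) {l : ℕ} (hl0 : 0 < l)
    (hl : l < Function.minimalPeriod ρ x) : (ρ ^ l) x ≠ x := fun h =>
  hl0.ne' (pow_injOn ρ x hl (minimalPeriod_pos ρ x) (by simpa using h))

variable {ι : Type*} [DecidableEq ι]

lemma IsLabelling.fiberCard_eq {ρ : Equiv.Perm V} {c : V → ι} (h : IsLabelling ρ c) (x : V) :
    fiberCard c (c x) = Function.minimalPeriod ρ x := by
  have h1 : ({z | c z = c x} : Finset V) =
      (range (Function.minimalPeriod ρ x)).image fun k => (ρ ^ k) x := by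
    ext z
    rw [Finset.mem_filter, eq_comm, h.eq_iff, sameCycle_iff_exists_lt]
    simp
  rw [fiberCard, h1, Finset.card_image_of_injOn, Finset.card_range]
  intro k hk l hl hkl
  exact pow_injOn ρ x (by simpa using hk) (by simpa using hl) hkl

lemma apply_eq_of_sameCycle {α : Type*} {ρ : Equiv.Perm V} {f : V → α}
    (h : ∀ z, f (ρ z) = f z) {x y : V} (hxy : ρ.SameCycle x y) : f x = f y := by
  obtain ⟨k, -, rfl⟩ := hxy.exists_pow_eq'
  induction k with
  | zero => simp
  | succ k ih =>
    rw [pow_succ', Equiv.Perm.mul_apply, h]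
    exact ih ⟨k, by simp⟩

/-- The orbit under the product follows that of `ρ` as long as it avoids `x` and `y`. -/
lemma swap_mul_pow_apply {ρ : Equiv.Perm V} {x y z : V} {k : ℕ}
    (h : ∀ l, 0 < l → l ≤ k → (ρ ^ l) z ≠ x ∧ (ρ ^ l) z ≠ y) :
    ((Equiv.swap x y * ρ) ^ k) z = (ρ ^ k) z := by
  induction k with
  | zero => simp
  | succ k ih =>
    have hk := h (k + 1) (Nat.succ_pos k) le_rfl
    rw [pow_succ', Equiv.Perm.mul_apply, ih fun l hl hlk => h l hl (by omega),
      Equiv.Perm.mul_apply, ← Equiv.Perm.mul_apply ρ, ← pow_succ',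
      Equiv.swap_apply_of_ne_of_ne hk.1 hk.2]

lemma sameCycle_pow_apply (ρ : Equiv.Perm V) (k : ℕ) (x : V) : ρ.SameCycle x ((ρ ^ k) x) :=
  ⟨k, by simp⟩

/-- The labelling after joining the cycles `i` and `j`. -/
def joinLabel (c : V → ι) (i j : ι) (h : i ≠ j) (z : V) : {l : ι // l ≠ j} :=
  if hz : c z = j then ⟨i, h⟩ else ⟨c z, hz⟩

lemma coe_joinLabel (c : V → ι) (i j : ι) (h : i ≠ j) (z : V) :
    (joinLabel c i j h z : ι) = if c z = j then i else c z := by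
  rw [joinLabel]; split_ifs <;> rfl

lemma IsLabelling.join {ρ : Equiv.Perm V} {c : V → ι} (h : IsLabelling ρ c) {x y : V}
    (hxy : c x ≠ c y) : IsLabelling (Equiv.swap x y * ρ) (joinLabel c (c x) (c y) hxy) := by
  set ρ' := Equiv.swap x y * ρ with hρ'
  have hc : ∀ z, c (ρ z) = c z := fun z => (h.eq_iff _ _).2 (sameCycle_apply_left.2 (SameCycle.refl _ _))
  have hc' : ∀ z k, c ((ρ ^ k) z) = c z := fun z k =>
    (h.eq_iff _ _).2 (sameCycle_pow_apply ρ k z).symm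
  have hxy' : ρ'.SameCycle x y := by
    have hp := minimalPeriod_pos ρ x
    -- The orbit of `x` goes once round its old cycle; the last step would return to `x` and is
    -- diverted to `y`.
    have h1 : (ρ' ^ (Function.minimalPeriod ρ x)) x = y := by
      obtain ⟨k, hk⟩ := Nat.exists_eq_succ_of_ne_zero hp.ne'
      have h2 := pow_minimalPeriod_apply ρ x
      rw [hk] at h2
      rw [hk, pow_succ', Equiv.Perm.mul_apply, hρ', swap_mul_pow_apply, Equiv.Perm.mul_apply,
        ← Equiv.Perm.mul_apply ρ, ← pow_succ', h2, Equiv.swap_apply_left]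
      intro l hl hlk
      refine ⟨pow_apply_ne ρ x hl (by omega), fun he => hxy ?_⟩
      rw [← he, hc']
    exact ⟨(Function.minimalPeriod ρ x : ℕ), by rw [zpow_natCast, h1]⟩
  have hsw : ∀ w, ρ'.SameCycle w (Equiv.swap x y w) := fun w => by
    rcases eq_or_ne w x with rfl | hx
    · rwa [Equiv.swap_apply_left]
    rcases eq_or_ne w y with rfl | hy
    · rw [Equiv.swap_apply_right]; exact hxy'.symm
    · rw [Equiv.swap_apply_of_ne_of_ne hx hy]
  have hstep : ∀ z, ρ'.SameCycle z (ρ z) := fun z =>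
    (sameCycle_apply_right.2 (SameCycle.refl ρ' z)).trans (hsw (ρ z)).symm
  have hsub : ∀ u v, ρ.SameCycle u v → ρ'.SameCycle u v := fun u v huv => by
    obtain ⟨k, -, rfl⟩ := huv.exists_pow_eq'
    clear huv
    induction k with
    | zero => exact SameCycle.refl _ _
    | succ k ih =>
      rw [pow_succ', Equiv.Perm.mul_apply]
      exact ih.trans (hstep _)
  refine ⟨fun u v => ⟨fun huv => ?_, fun huv => ?_⟩, ?_⟩
  · rw [Subtype.ext_iff, coe_joinLabel, coe_joinLabel] at huv
    split_ifs at huv with h1 h2 h2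
    · exact hsub u v ((h.eq_iff _ _).1 (h1.trans h2.symm))
    · exact ((hsub u y ((h.eq_iff _ _).1 h1)).trans hxy'.symm).trans
        (hsub x v ((h.eq_iff _ _).1 huv))
    · exact ((hsub u x ((h.eq_iff _ _).1 huv)).trans hxy').trans
        (hsub y v ((h.eq_iff _ _).1 h2.symm))
    · exact hsub u v ((h.eq_iff _ _).1 huv)
  · refine apply_eq_of_sameCycle (fun z => ?_) huv
    rw [Subtype.ext_iff, coe_joinLabel, coe_joinLabel, hρ', Equiv.Perm.mul_apply]
    rw [← hc z]
    generalize ρ z = w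
    rcases eq_or_ne w x with rfl | hx
    · rw [Equiv.swap_apply_left, if_pos rfl, if_neg hxy]
    rcases eq_or_ne w y with rfl | hy
    · rw [Equiv.swap_apply_right, if_pos rfl, if_neg hxy]
    · rw [Equiv.swap_apply_of_ne_of_ne hx hy]
  · rintro ⟨l, hl⟩
    obtain ⟨z, rfl⟩ := h.surjective l
    exact ⟨z, by rw [joinLabel, dif_neg hl]⟩

lemma fiberCard_joinLabel (c : V → ι) (i j : ι) (h : i ≠ j) :
    fiberCard (joinLabel c i j h) = joinLen (fiberCard c) i j := by
  funext ⟨l, hl⟩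
  simp only [fiberCard, joinLen, Subtype.ext_iff, coe_joinLabel]
  split_ifs with h1
  · subst h1
    rw [← Finset.card_union_of_disjoint, ← Finset.filter_or]
    · congr 1
      ext z
      simp only [Finset.mem_filter, Finset.mem_univ, true_and]
      split_ifs with h2 <;> simp [h2]
    · rw [Finset.disjoint_filter]
      intro z _ h2 h3
      exact h (h2.symm.trans h3)
  · congr 1
    ext z
    simp only [Finset.mem_filter, Finset.mem_univ, true_and]
    split_ifs with h2
    · simp [h2, Ne.symm h1, Ne.symm hl]
    · rfl

/-- The labelling after cutting off the set `S` from a cycle. -/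
def cutLabel (c : V → ι) (S : Finset V) (z : V) : Option ι := if z ∈ S then none else some (c z)

/-- The elements `x, ρ x, …, ρ ^ (k - 1) x`. -/
def orbitSegment (ρ : Equiv.Perm V) (x : V) (k : ℕ) : Finset V :=
  (range k).image fun l => (ρ ^ l) x

lemma card_orbitSegment (ρ : Equiv.Perm V) (x : V) {k : ℕ}
    (hk : k ≤ Function.minimalPeriod ρ x) : #(orbitSegment ρ x k) = k := by
  rw [orbitSegment, Finset.card_image_of_injOn, Finset.card_range]
  intro a ha b hb hab
  rw [Finset.coe_range, Set.mem_Iio] at ha hb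
  exact pow_injOn ρ x (by omega) (by omega) hab

lemma pow_apply_mem_orbitSegment (ρ : Equiv.Perm V) (x : V) {k l : ℕ}
    (hk : k ≤ Function.minimalPeriod ρ x) (hl : l < Function.minimalPeriod ρ x) :
    (ρ ^ l) x ∈ orbitSegment ρ x k ↔ l < k := by
  rw [orbitSegment, Finset.mem_image]
  constructor
  · rintro ⟨a, ha, hal⟩
    rw [Finset.mem_range] at ha
    rwa [← pow_injOn ρ x (by omega) hl hal]
  · intro h
    exact ⟨l, Finset.mem_range.2 h, rfl⟩

/-- The segment `x, ρ x, …, ρ^(k-1) x` closes up, since its next element `y = ρ^k x` is replaced by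
`x`; the rest of the cycle closes up through `y`. -/
lemma IsLabelling.cut {ρ : Equiv.Perm V} {c : V → ι} (h : IsLabelling ρ c) {x : V} {k : ℕ}
    (hk0 : 0 < k) (hk : k < Function.minimalPeriod ρ x) :
    IsLabelling (Equiv.swap x ((ρ ^ k) x) * ρ) (cutLabel c (orbitSegment ρ x k)) := by
  set y := (ρ ^ k) x with hy
  set ρ' := Equiv.swap x y * ρ with hρ'
  set S := orbitSegment ρ x k with hS
  have hc : ∀ z, c (ρ z) = c z := fun z => (h.eq_iff _ _).2 (sameCycle_apply_left.2 (SameCycle.refl _ _))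
  have hc' : ∀ z k, c ((ρ ^ k) z) = c z := fun z k =>
    (h.eq_iff _ _).2 (sameCycle_pow_apply ρ k z).symm
  have hcS : ∀ z ∈ S, c z = c x := fun z hz => by
    obtain ⟨l, _, rfl⟩ := Finset.mem_image.1 hz
    exact hc' x l
  have hcy : c y = c x := hc' x k
  have hyS : y ∉ S := fun hyS => lt_irrefl _ ((pow_apply_mem_orbitSegment ρ x hk.le hk).1 hyS)
  have hmaps : Set.MapsTo ρ' (S : Set V) S := fun z hz => by
    obtain ⟨l, hl, rfl⟩ := Finset.mem_image.1 (Finset.mem_coe.1 hz)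
    rw [Finset.mem_range] at hl
    rw [Finset.mem_coe, hρ', Equiv.Perm.mul_apply, ← Equiv.Perm.mul_apply ρ, ← pow_succ']
    rcases Nat.lt_or_ge (l + 1) k with h1 | h1
    · rw [Equiv.swap_apply_of_ne_of_ne (pow_apply_ne ρ x (by omega) (by omega))
        fun h2 => absurd (pow_injOn ρ x (by omega) hk h2) h1.ne]
      exact Finset.mem_image.2 ⟨l + 1, Finset.mem_range.2 h1, rfl⟩
    · rw [show l + 1 = k by omega, ← hy, Equiv.swap_apply_right]
      exact Finset.mem_image.2 ⟨0, Finset.mem_range.2 hk0, by simp⟩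
  -- An injective self-map of a finite set is onto, so nothing outside the segment enters it.
  have hmaps' : ∀ z, ρ' z ∈ S ↔ z ∈ S := fun z => by
    refine ⟨fun hz => ?_, fun hz => hmaps hz⟩
    obtain ⟨s, hs, hsz⟩ :=
      Finset.surjOn_of_injOn_of_card_le ρ' hmaps ρ'.injective.injOn le_rfl (Finset.mem_coe.2 hz)
    exact ρ'.injective hsz ▸ Finset.mem_coe.1 hs
  have hxs : ∀ u ∈ S, ρ'.SameCycle x u := fun u hu => by
    obtain ⟨l, hl, rfl⟩ := Finset.mem_image.1 hu
    rw [Finset.mem_range] at hl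
    have h1 : (ρ' ^ l) x = (ρ ^ l) x := swap_mul_pow_apply fun m hm hml =>
      ⟨pow_apply_ne ρ x hm (by omega),
        fun h2 => absurd (pow_injOn ρ x (by omega) hk h2) (by omega)⟩
    rw [← h1]
    exact sameCycle_pow_apply ρ' l x
  have hys : ∀ u, u ∉ S → c u = c x → ρ'.SameCycle y u := fun u hu hcu => by
    obtain ⟨l, hl, rfl⟩ := (sameCycle_iff_exists_lt ρ x u).1 ((h.eq_iff _ _).1 hcu.symm)
    have hlk : k ≤ l := by
      by_contra hlk
      exact hu ((pow_apply_mem_orbitSegment ρ x hk.le hl).2 (by omega))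
    have h0 : ∀ m, (ρ ^ m) y = (ρ ^ (m + k)) x := fun m => by
      rw [pow_add, Equiv.Perm.mul_apply]
    have h1 : (ρ' ^ (l - k)) y = (ρ ^ (l - k)) y := swap_mul_pow_apply fun m hm hml => by
      rw [h0]
      exact ⟨pow_apply_ne ρ x (by omega) (by omega),
        fun h2 => absurd (pow_injOn ρ x (by omega) hk h2) (by omega)⟩
    rw [h0, Nat.sub_add_cancel hlk] at h1
    rw [← h1]
    exact sameCycle_pow_apply ρ' _ y
  refine ⟨fun u v => ⟨fun huv => ?_, fun huv => ?_⟩, ?_⟩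
  · rw [cutLabel, cutLabel] at huv
    split_ifs at huv with h1 h2 h2
    · exact (hxs u h1).symm.trans (hxs v h2)
    · rw [Option.some_inj] at huv
      by_cases hu : c u = c x
      · exact (hys u h1 hu).symm.trans (hys v h2 (huv.symm.trans hu))
      · obtain ⟨l, -, rfl⟩ := ((h.eq_iff _ _).1 huv).exists_pow_eq'
        have h3 : (ρ' ^ l) u = (ρ ^ l) u := swap_mul_pow_apply fun m _ _ =>
          ⟨fun h4 => hu (by rw [← hc' u m, h4]), fun h4 => hu (by rw [← hc' u m, h4, hcy])⟩
        rw [← h3]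
        exact sameCycle_pow_apply ρ' _ u
  · refine apply_eq_of_sameCycle (fun z => ?_) huv
    have h1 : c (ρ' z) = c z := by
      rw [hρ', Equiv.Perm.mul_apply, ← hc z]
      generalize ρ z = w
      rcases eq_or_ne w x with rfl | hx
      · rw [Equiv.swap_apply_left, hcy]
      rcases eq_or_ne w y with rfl | hy
      · rw [Equiv.swap_apply_right, hcy]
      · rw [Equiv.swap_apply_of_ne_of_ne hx hy]
    simp only [cutLabel, hmaps', h1]
  · rintro (_ | l)
    · refine ⟨x, if_pos (Finset.mem_image.2 ⟨0, Finset.mem_range.2 hk0, by simp⟩)⟩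
    · by_cases hl : l = c x
      · exact ⟨y, by rw [cutLabel, if_neg hyS, hcy, hl]⟩
      · obtain ⟨z, rfl⟩ := h.surjective l
        exact ⟨z, if_neg fun hz => hl (hcS z hz)⟩

lemma IsLabelling.fiberCard_cutLabel {ρ : Equiv.Perm V} {c : V → ι} (h : IsLabelling ρ c) {x : V}
    {k : ℕ} (hk : k ≤ Function.minimalPeriod ρ x) :
    fiberCard (cutLabel c (orbitSegment ρ x k)) = cutLen (fiberCard c) (c x) k := by
  have hcS : ∀ z ∈ orbitSegment ρ x k, c z = c x := fun z hz => by
    obtain ⟨l, _, rfl⟩ := Finset.mem_image.1 hz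
    exact (h.eq_iff _ _).2 (sameCycle_pow_apply ρ l x).symm
  funext o
  cases o with
  | none =>
    rw [cutLen, Option.elim_none, ← card_orbitSegment ρ x hk, fiberCard]
    congr 1
    ext z
    simp [cutLabel, card_orbitSegment ρ x hk]
  | some l =>
    rw [cutLen, Option.elim_some, fiberCard]
    by_cases hl : l = c x
    · subst hl
      rw [Function.update_self, fiberCard]
      conv_rhs => rw [← card_orbitSegment ρ x hk]
      rw [← Finset.card_sdiff_of_subset fun z hz =>
        Finset.mem_filter.2 ⟨Finset.mem_univ z, hcS z hz⟩]
      congr 1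
      ext z
      simp [cutLabel, and_comm]
    · rw [Function.update_of_ne hl, fiberCard]
      congr 1
      ext z
      by_cases hz : z ∈ orbitSegment ρ x k
      · simp [cutLabel, hz, hcS z hz, Ne.symm hl]
      · simp [cutLabel, hz]

end

/-! ### Counting factorizations into transpositions -/

section

open Finset Equiv.Perm

set_option linter.unusedSectionVars false

variable {V : Type*} [Fintype V] [DecidableEq V]

open Classical in
/-- The number of ways to multiply the permutation `ρ` by `m` transpositions so that the result is
a full cycle. -/
def facCount : ℕ → Equiv.Perm V → ℕ
  | 0, ρ => if ∀ x y, ρ.SameCycle x y then 1 else 0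
  | m + 1, ρ => ∑ τ : Equiv.Perm V with τ.IsSwap, facCount m (τ * ρ)

open Classical in
/-- The sequences of `m` transpositions that turn the permutation `ρ` into a full cycle. -/
def factorizations (m : ℕ) (ρ : Equiv.Perm V) : Finset (Fin m → Equiv.Perm V) :=
  {τ | (∀ k, (τ k).IsSwap) ∧ ∀ x y, ((List.ofFn τ).prod * ρ).SameCycle x y}

lemma mem_factorizations {m : ℕ} {ρ : Equiv.Perm V} {τ : Fin m → Equiv.Perm V} :
    τ ∈ factorizations m ρ ↔
      (∀ k, (τ k).IsSwap) ∧ ∀ x y, ((List.ofFn τ).prod * ρ).SameCycle x y := by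
  simp [factorizations]

open Classical in
lemma card_factorizations (m : ℕ) (ρ : Equiv.Perm V) : #(factorizations m ρ) = facCount m ρ := by
  simp only [factorizations]
  induction m generalizing ρ with
  | zero =>
    rw [facCount, Finset.card_filter, Fintype.sum_unique]
    simp
  | succ m ih =>
    -- The last transposition of the list stands next to `ρ`, so it is the one that the recursion of
    -- `facCount` splits off.
    rw [facCount, Finset.card_filter, ← (Fin.snocEquiv fun _ => Equiv.Perm V).sum_comp,
      Fintype.sum_prod_type, Finset.sum_filter]
    refine Finset.sum_congr rfl fun t _ => ?_
    split_ifs with ht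
    · rw [← ih, Finset.card_filter]
      refine Finset.sum_congr rfl fun τ _ => ?_
      congr 1
      rw [List.ofFn_succ']
      simp [Fin.snocEquiv, Fin.forall_fin_succ', ht, mul_assoc]
    · refine Finset.sum_eq_zero fun τ _ => if_neg fun h => ht ?_
      simpa [Fin.snocEquiv] using h.1 (Fin.last m)

lemma swap_eq_swap_iff {a b x y : V} (hab : a ≠ b) :
    Equiv.swap x y = Equiv.swap a b ↔ x = a ∧ y = b ∨ x = b ∧ y = a := by
  constructor
  · intro h
    have h1 : Equiv.swap x y a = b := by rw [h, Equiv.swap_apply_left]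
    rcases eq_or_ne a x with rfl | hx
    · rw [Equiv.swap_apply_left] at h1
      exact Or.inl ⟨rfl, h1⟩
    rcases eq_or_ne a y with rfl | hy
    · rw [Equiv.swap_apply_right] at h1
      exact Or.inr ⟨h1, rfl⟩
    · rw [Equiv.swap_apply_of_ne_of_ne hx hy] at h1
      exact absurd h1 hab
  · rintro (⟨rfl, rfl⟩ | ⟨rfl, rfl⟩)
    · rfl
    · exact Equiv.swap_comm _ _

-- Every transposition comes from exactly two ordered pairs of distinct points.
open Classical in
lemma two_mul_sum_isSwap (f : Equiv.Perm V → ℚ) :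
    2 * ∑ τ : Equiv.Perm V with τ.IsSwap, f τ =
      ∑ x, ∑ y ∈ univ.erase x, f (Equiv.swap x y) := by
  have h1 : ∑ x, ∑ y ∈ univ.erase x, f (Equiv.swap x y) =
      ∑ p ∈ (univ : Finset V).offDiag, f (Equiv.swap p.1 p.2) := by
    rw [Finset.sum_sigma']
    refine Finset.sum_nbij' (fun s => (s.1, s.2)) (fun p => ⟨p.1, p.2⟩) ?_ ?_ ?_ ?_ ?_ <;>
      simp [eq_comm]
  rw [h1, ← Finset.sum_fiberwise_of_maps_to (t := {τ : Equiv.Perm V | τ.IsSwap})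
    (g := fun p : V × V => Equiv.swap p.1 p.2), Finset.mul_sum]
  · refine Finset.sum_congr rfl fun τ hτ => ?_
    obtain ⟨a, b, hab, rfl⟩ := (Finset.mem_filter.1 hτ).2
    have h2 : ({p ∈ (univ : Finset V).offDiag | Equiv.swap p.1 p.2 = Equiv.swap a b}) =
        {(a, b), (b, a)} := by
      ext ⟨x, y⟩
      simp only [Finset.mem_filter, Finset.mem_offDiag, Finset.mem_univ, true_and,
        swap_eq_swap_iff hab, Finset.mem_insert, Finset.mem_singleton, Prod.mk.injEq]
      refine ⟨fun h => h.2, fun h => ⟨?_, h⟩⟩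
      rcases h with ⟨rfl, rfl⟩ | ⟨rfl, rfl⟩
      · exact hab
      · exact hab.symm
    rw [h2, Finset.sum_pair (by simp [hab]), Equiv.swap_comm b a]
    ring
  · intro p hp
    rw [Finset.mem_filter]
    exact ⟨Finset.mem_univ _, p.1, p.2, (Finset.mem_offDiag.1 hp).2.2, rfl⟩

lemma sum_label {ι : Type*} [Fintype ι] [DecidableEq ι] (c : V → ι) (f : ι → ℚ) :
    ∑ x, f (c x) = ∑ i, (fiberCard c i : ℚ) * f i := by
  rw [← Finset.sum_fiberwise univ c]
  refine Finset.sum_congr rfl fun i _ => ?_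
  rw [Finset.sum_congr rfl fun x hx => by rw [(Finset.mem_filter.1 hx).2], Finset.sum_const,
    nsmul_eq_mul, fiberCard]

lemma sum_label_ne {ι : Type*} [Fintype ι] [DecidableEq ι] (c : V → ι) (i : ι) (f : ι → ℚ) :
    ∑ x with c x ≠ i, f (c x) = ∑ j ∈ univ.erase i, (fiberCard c j : ℚ) * f j := by
  rw [Finset.sum_filter, sum_label c fun j => if j ≠ i then f j else 0]
  simp only [mul_ite, mul_zero]
  rw [← Finset.sum_filter, Finset.filter_ne']

lemma sum_fiberCard {ι : Type*} [Fintype ι] [DecidableEq ι] (c : V → ι) :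
    ∑ i, fiberCard c i = Fintype.card V := by
  rw [← Finset.card_univ, Finset.card_eq_sum_card_fiberwise (f := c) (t := univ) (by simp)]
  rfl

/-- The partner `y` of `x` in a swap lies on another cycle, a join, or equals `ρ^k x` for a unique
`k` below the cycle length, a cut. -/
lemma IsLabelling.sum_erase {ι : Type*} [DecidableEq ι] {ρ : Equiv.Perm V} {c : V → ι}
    (h : IsLabelling ρ c) (x : V) (f : V → ℚ) :
    ∑ y ∈ univ.erase x, f y = ∑ y with c y ≠ c x, f y +
      ∑ k ∈ Ico 1 (Function.minimalPeriod ρ x), f ((ρ ^ k) x) := by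
  have h1 : ({y ∈ univ.erase x | ¬ c y ≠ c x}) =
      (Ico 1 (Function.minimalPeriod ρ x)).image fun k => (ρ ^ k) x := by
    ext y
    simp only [Finset.mem_filter, Finset.mem_erase, Finset.mem_univ, and_true, not_not,
      Finset.mem_image, Finset.mem_Ico]
    rw [eq_comm (b := c x), h.eq_iff, sameCycle_iff_exists_lt]
    constructor
    · rintro ⟨hy, k, hk, rfl⟩
      refine ⟨k, ⟨Nat.one_le_iff_ne_zero.2 ?_, hk⟩, rfl⟩
      rintro rfl
      simp at hy
    · rintro ⟨k, ⟨hk0, hk⟩, rfl⟩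
      exact ⟨pow_apply_ne ρ x hk0 hk, k, hk, rfl⟩
  have h2 : ({y ∈ univ.erase x | c y ≠ c x}) = ({y | c y ≠ c x} : Finset V) := by
    ext y
    simp only [Finset.mem_filter, Finset.mem_erase, Finset.mem_univ, and_true, true_and,
      and_iff_right_iff_imp]
    rintro hy rfl
    exact hy rfl
  rw [← Finset.sum_filter_add_sum_filter_not (univ.erase x) (fun y => c y ≠ c x), h1, h2,
    Finset.sum_image]
  intro k hk l hl hkl
  rw [Finset.coe_Ico, Set.mem_Ico] at hk hl
  exact pow_injOn ρ x hk.2 hl.2 hkl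

lemma coeff_natCast_mul (m n : ℕ) (f : PowerSeries ℚ) :
    PowerSeries.coeff m ((n : PowerSeries ℚ) * f) = n * PowerSeries.coeff m f := by
  rw [← map_natCast (PowerSeries.C (R := ℚ)), PowerSeries.coeff_C_mul]

lemma coeff_succ_countSeries {ι : Type*} [Fintype ι] [DecidableEq ι] [Nonempty ι] {d : ℕ}
    (hd : d ≠ 0) (b : ι → ℕ) (hb : ∑ i, b i = d) (m : ℕ) :
    2 * (((m + 1 : ℕ) : ℚ) * PowerSeries.coeff (m + 1) (countSeries d b)) =
      ∑ i, (b i : ℚ) * (∑ j ∈ univ.erase i,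
        (b j : ℚ) * PowerSeries.coeff m (countSeries d (joinLen b i j)) +
      ∑ k ∈ Ico 1 (b i), PowerSeries.coeff m (countSeries d (cutLen b i k))) := by
  have h := congrArg (PowerSeries.coeff m) (derivative_countSeries hd b hb)
  have h2 : (2 : PowerSeries ℚ) = ((2 : ℕ) : PowerSeries ℚ) := by norm_num
  rw [h2, coeff_natCast_mul, PowerSeries.coeff_derivative, map_add, map_sum, map_sum,
    ← Finset.sum_add_distrib] at h
  simp only [map_sum, mul_assoc, coeff_natCast_mul] at h
  push_cast at h ⊢
  rw [mul_comm ((m : ℚ) + 1), h]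
  refine Finset.sum_congr rfl fun i _ => ?_
  rw [mul_add, Finset.mul_sum (univ.erase i)]

/-- The factor `(d s)^(n-1)` vanishes at `s = 0` unless there is a single cycle, and then the
constant term is `1`. -/
lemma facCount_zero_eq {ι : Type*} [Fintype ι] [DecidableEq ι] [Nonempty V] {ρ : Equiv.Perm V}
    {c : V → ι} (h : IsLabelling ρ c) :
    (facCount 0 ρ : ℚ) = PowerSeries.coeff 0 (countSeries (Fintype.card V) (fiberCard c)) := by
  have hV : (Fintype.card V : ℚ) ≠ 0 := by exact_mod_cast Fintype.card_ne_zero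
  have hι : Nonempty ι := ⟨c (Classical.arbitrary V)⟩
  rw [PowerSeries.coeff_zero_eq_constantCoeff_apply, countSeries, facCount]
  simp only [map_mul, map_pow, PowerSeries.constantCoeff_C, PowerSeries.constantCoeff_X, mul_zero]
  by_cases hs : Fintype.card ι = 1
  · have hss : Subsingleton ι := Fintype.card_le_one_iff_subsingleton.1 hs.le
    have hu : Unique ι := uniqueOfSubsingleton (Classical.arbitrary ι)
    rw [if_pos fun x y => (h.eq_iff x y).1 (Subsingleton.elim _ _), hs]
    have h1 := sum_fiberCard c
    rw [Fintype.sum_unique] at h1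
    rw [Fintype.prod_unique, h1, div_self hV,
      ← PowerSeries.coeff_zero_eq_constantCoeff_apply, PowerSeries.coeff_rescale,
      PowerSeries.coeff_zero_eq_constantCoeff_apply, hurwitzSeries, map_mul, map_prod]
    have h2 : ∀ i : ι, PowerSeries.constantCoeff
        (PowerSeries.rescale (fiberCard c i : ℚ) sinhc) = 1 := fun i => by
      rw [← PowerSeries.coeff_zero_eq_constantCoeff_apply, PowerSeries.coeff_rescale,
        PowerSeries.coeff_zero_eq_constantCoeff_apply, constantCoeff_sinhc]
      simp
    simp [h2, constantCoeff_sinhc]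
  · have hpos : 0 < Fintype.card ι := Fintype.card_pos
    rw [if_neg, zero_pow (by omega)]
    · simp
    · intro hf
      apply hs
      refine le_antisymm (Fintype.card_le_one_iff.2 fun i j => ?_) hpos
      obtain ⟨x, rfl⟩ := h.surjective i
      obtain ⟨y, rfl⟩ := h.surjective j
      exact (h.eq_iff x y).2 (hf x y)

/-- The number of factorizations of a permutation with given cycle lengths. -/
theorem facCount_eq [Nonempty V] (m : ℕ) {ι : Type} [Fintype ι] [DecidableEq ι]
    {ρ : Equiv.Perm V} {c : V → ι} (h : IsLabelling ρ c) :
    (facCount m ρ : ℚ) =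
      m ! * PowerSeries.coeff m (countSeries (Fintype.card V) (fiberCard c)) := by
  -- The label type must vary: a join removes a label and a cut adds one.
  induction m generalizing ι ρ with
  | zero => rw [facCount_zero_eq h]; simp
  | succ m ih =>
    have hι : Nonempty ι := ⟨c (Classical.arbitrary V)⟩
    have hd : Fintype.card V ≠ 0 := Fintype.card_ne_zero
    have h1 := coeff_succ_countSeries hd (fiberCard c) (sum_fiberCard c) m
    rw [Nat.factorial_succ, Nat.cast_mul]
    apply mul_left_cancel₀ (two_ne_zero (α := ℚ))
    have h2 : (2 : ℚ) * (((m + 1 : ℕ) : ℚ) * (m ! : ℚ) * PowerSeries.coeff (m + 1)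
        (countSeries (Fintype.card V) (fiberCard c))) = (m ! : ℚ) * (2 * (((m + 1 : ℕ) : ℚ) *
          PowerSeries.coeff (m + 1) (countSeries (Fintype.card V) (fiberCard c)))) := by ring
    -- The weight `b i` is rewritten as a sum over the points `x` of cycle `i`, so that both sides
    -- can be compared point by point.
    rw [h2, h1, ← sum_label c, facCount, Nat.cast_sum,
      two_mul_sum_isSwap (fun τ => (facCount m (τ * ρ) : ℚ)), Finset.mul_sum]
    refine Finset.sum_congr rfl fun x _ => ?_
    rw [h.sum_erase, h.fiberCard_eq, mul_add, ← sum_label_ne c (c x), Finset.mul_sum,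
      Finset.mul_sum]
    congr 1
    · refine Finset.sum_congr rfl fun y hy => ?_
      have hxy : c x ≠ c y := (Finset.mem_filter.1 hy).2.symm
      rw [ih (h.join hxy), fiberCard_joinLabel]
    · refine Finset.sum_congr rfl fun k hk => ?_
      rw [Finset.mem_Ico] at hk
      rw [ih (h.cut hk.1 hk.2), h.fiberCard_cutLabel hk.2.le]

end

/-! ### Counting labelled permutations, and the Hurwitz number formula -/

section

open Finset Equiv.Perm

set_option linter.unusedSectionVars false

variable {V : Type*} [Fintype V] [DecidableEq V] {ι : Type*} [Fintype ι] [DecidableEq ι]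

open Classical in
/-- The permutations with labelled cycles such that the cycle with label `i` has length `b i`. -/
def labelledPerms (V : Type*) [Fintype V] [DecidableEq V] (b : ι → ℕ) :
    Finset (Equiv.Perm V × (V → ι)) :=
  {p | IsLabelling p.1 p.2 ∧ ∀ i, fiberCard p.2 i = b i}

open Classical in
/-- The permutations with labelled cycles of given lengths and a base point on every cycle. -/
def pointedPerms (V : Type*) [Fintype V] [DecidableEq V] (b : ι → ℕ) :
    Finset ((Equiv.Perm V × (V → ι)) × (ι → V)) :=
  {p | p.1 ∈ labelledPerms V b ∧ ∀ i, p.1.2 (p.2 i) = i}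

lemma mem_labelledPerms {b : ι → ℕ} {p : Equiv.Perm V × (V → ι)} :
    p ∈ labelledPerms V b ↔ IsLabelling p.1 p.2 ∧ ∀ i, fiberCard p.2 i = b i := by
  simp [labelledPerms]

lemma mem_pointedPerms {b : ι → ℕ} {p : (Equiv.Perm V × (V → ι)) × (ι → V)} :
    p ∈ pointedPerms V b ↔ p.1 ∈ labelledPerms V b ∧ ∀ i, p.1.2 (p.2 i) = i := by
  simp [pointedPerms]

lemma card_pointedPerms (b : ι → ℕ) :
    #(pointedPerms V b) = #(labelledPerms V b) * ∏ i, b i := by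
  classical
  rw [Finset.card_eq_sum_card_fiberwise (f := Prod.fst) (t := labelledPerms V b)
    (fun p hp => (mem_pointedPerms.1 hp).1), Finset.sum_const_nat]
  rintro ⟨ρ, c⟩ hρ
  have h1 : ({p ∈ pointedPerms V b | p.1 = (ρ, c)}) =
      (Fintype.piFinset fun i => ({x | c x = i} : Finset V)).image fun x => ((ρ, c), x) := by
    ext ⟨p, x⟩
    simp only [Finset.mem_filter, mem_pointedPerms, Finset.mem_image, Fintype.mem_piFinset,
      Finset.mem_univ, true_and, Prod.mk.injEq]
    constructor
    · rintro ⟨⟨-, h⟩, rfl⟩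
      exact ⟨x, h, rfl, rfl⟩
    · rintro ⟨x, h, rfl, rfl⟩
      exact ⟨⟨hρ, h⟩, rfl⟩
  rw [h1, Finset.card_image_of_injective _ (Prod.mk_right_injective _), Fintype.card_piFinset]
  exact Finset.prod_congr rfl fun i _ => (mem_labelledPerms.1 hρ).2 i

/-- The permutation that rotates every block `Fin (b i)`. -/
def blockRotate (b : ι → ℕ) : Equiv.Perm (Σ i, Fin (b i)) :=
  Equiv.sigmaCongrRight fun i => finRotate (b i)

lemma coe_finRotate {N : ℕ} (k : Fin N) : (finRotate N k : ℕ) = (k + 1) % N := by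
  cases N with
  | zero => exact k.elim0
  | succ N =>
    rw [finRotate_apply, Fin.val_add, Fin.val_one', Nat.add_mod_mod]

lemma finRotate_mk {N k : ℕ} (h : k + 1 < N) :
    finRotate N ⟨k, by omega⟩ = ⟨k + 1, h⟩ := by
  rw [Fin.ext_iff, coe_finRotate, Nat.mod_eq_of_lt h]

lemma permCongr_blockRotate_pow_apply (b : ι → ℕ) (θ : (Σ i, Fin (b i)) ≃ V) (i : ι) {k : ℕ}
    (h : k < b i) :
    ((θ.permCongr (blockRotate b)) ^ k) (θ ⟨i, ⟨0, by omega⟩⟩) = θ ⟨i, ⟨k, h⟩⟩ := by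
  induction k with
  | zero => simp
  | succ k ih =>
    rw [pow_succ', Equiv.Perm.mul_apply, ih (by omega), Equiv.permCongr_apply,
      Equiv.symm_apply_apply]
    congr 1
    change (⟨i, finRotate (b i) ⟨k, _⟩⟩ : Σ i, Fin (b i)) = _
    rw [finRotate_mk h]

/-- The permutation with labelled cycles and base points that corresponds to a numbering. -/
def pointedOfEquiv (b : ι → ℕ) (hb : ∀ i, 0 < b i) (θ : (Σ i, Fin (b i)) ≃ V) :
    (Equiv.Perm V × (V → ι)) × (ι → V) :=
  ((θ.permCongr (blockRotate b), fun z => (θ.symm z).1), fun i => θ ⟨i, ⟨0, hb i⟩⟩)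

lemma pointedOfEquiv_mem (b : ι → ℕ) (hb : ∀ i, 0 < b i) (θ : (Σ i, Fin (b i)) ≃ V) :
    pointedOfEquiv b hb θ ∈ pointedPerms V b := by
  rw [mem_pointedPerms, mem_labelledPerms]
  refine ⟨⟨⟨fun x y => ⟨fun h => ?_, fun h => ?_⟩, fun i => ?_⟩, fun i => ?_⟩, fun i => ?_⟩
  · obtain ⟨⟨i, k⟩, rfl⟩ := θ.surjective x
    obtain ⟨⟨j, l⟩, rfl⟩ := θ.surjective y
    simp only [pointedOfEquiv, Equiv.symm_apply_apply] at h ⊢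
    subst h
    have h1 := permCongr_blockRotate_pow_apply b θ i k.2
    have h2 := permCongr_blockRotate_pow_apply b θ i l.2
    rw [← h1, ← h2]
    exact (sameCycle_pow_apply _ _ _).symm.trans (sameCycle_pow_apply _ _ _)
  · refine apply_eq_of_sameCycle (fun z => ?_) h
    simp [pointedOfEquiv, Equiv.permCongr_apply, blockRotate]
  · exact ⟨θ ⟨i, ⟨0, hb i⟩⟩, by simp [pointedOfEquiv]⟩
  · have h1 : ({z | (pointedOfEquiv b hb θ).1.2 z = i} : Finset V) =
        (univ : Finset (Fin (b i))).image fun k => θ ⟨i, k⟩ := by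
      ext z
      obtain ⟨⟨j, l⟩, rfl⟩ := θ.surjective z
      rw [Finset.mem_filter, Finset.mem_image]
      simp only [pointedOfEquiv, Finset.mem_univ, true_and, Equiv.symm_apply_apply,
        EmbeddingLike.apply_eq_iff_eq]
      constructor
      · rintro rfl
        exact ⟨l, rfl⟩
      · rintro ⟨k, hk⟩
        exact (congrArg Sigma.fst hk).symm
    rw [fiberCard, h1, Finset.card_image_of_injective, Finset.card_univ, Fintype.card_fin]
    intro k l hkl
    simpa using hkl
  · simp [pointedOfEquiv]

/-- The numbering is recovered as `θ(i, k) = ρ^k (x_i)`, with `x_i` the base points; the same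
formula gives surjectivity. -/
lemma pointedOfEquiv_injective (b : ι → ℕ) (hb : ∀ i, 0 < b i) :
    Function.Injective (pointedOfEquiv (V := V) b hb) := by
  intro θ η h
  rw [pointedOfEquiv, pointedOfEquiv, Prod.mk.injEq, Prod.mk.injEq] at h
  ext ⟨i, k⟩
  rw [← permCongr_blockRotate_pow_apply b θ i k.2, ← permCongr_blockRotate_pow_apply b η i k.2,
    h.1.1]
  congr 1
  exact congrFun h.2 i

lemma exists_pointedOfEquiv_eq (b : ι → ℕ) (hb : ∀ i, 0 < b i)
    {p : (Equiv.Perm V × (V → ι)) × (ι → V)} (hp : p ∈ pointedPerms V b) :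
    ∃ θ, pointedOfEquiv b hb θ = p := by
  obtain ⟨⟨ρ, c⟩, x⟩ := p
  rw [mem_pointedPerms, mem_labelledPerms] at hp
  obtain ⟨⟨h, hbc⟩, hx⟩ := hp
  dsimp only at h hbc hx
  have hper : ∀ i, Function.minimalPeriod ρ (x i) = b i := fun i => by
    rw [← h.fiberCard_eq, hx, hbc]
  have hc : ∀ i (k : ℕ), c ((ρ ^ k) (x i)) = i := fun i k => by
    rw [← (h.eq_iff _ _).2 (sameCycle_pow_apply ρ k (x i)), hx]
  let f : (Σ i, Fin (b i)) → V := fun s => (ρ ^ (s.2 : ℕ)) (x s.1)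
  have hf : Function.Bijective f := by
    rw [Fintype.bijective_iff_injective_and_card]
    constructor
    · rintro ⟨i, k⟩ ⟨j, l⟩ hkl
      have h1 := congrArg c hkl
      simp only [f, hc] at h1
      subst h1
      have h2 := pow_injOn ρ (x i) (by rw [hper]; exact k.2) (by rw [hper]; exact l.2) hkl
      have h3 : k = l := Fin.ext h2
      rw [h3]
    · rw [Fintype.card_sigma, ← sum_fiberCard c]
      exact Finset.sum_congr rfl fun i _ => by rw [Fintype.card_fin, hbc]
  let θ := Equiv.ofBijective f hf
  have hθ : ∀ s, θ s = f s := fun _ => rfl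
  refine ⟨θ, ?_⟩
  rw [pointedOfEquiv, Prod.mk.injEq, Prod.mk.injEq]
  refine ⟨⟨?_, ?_⟩, ?_⟩
  · ext z
    obtain ⟨⟨i, k⟩, rfl⟩ := θ.surjective z
    rw [Equiv.permCongr_apply, Equiv.symm_apply_apply]
    change (ρ ^ (finRotate (b i) k : ℕ)) (x i) = ρ ((ρ ^ (k : ℕ)) (x i))
    rw [coe_finRotate, ← Equiv.Perm.mul_apply ρ, ← pow_succ', ← Equiv.Perm.iterate_eq_pow,
      ← Equiv.Perm.iterate_eq_pow, ← Function.iterate_mod_minimalPeriod_eq (n := k + 1),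
      hper]
  · funext z
    obtain ⟨⟨i, k⟩, rfl⟩ := θ.surjective z
    rw [Equiv.symm_apply_apply, hθ]
    exact (hc i k).symm
  · funext i
    simp [hθ, f]

/-- Base points on the cycles can be chosen in `∏ b i` ways, and pointed permutations correspond to
the `d!` numberings of the `d` points by positions in the blocks. -/
theorem card_labelledPerms_mul_prod (b : ι → ℕ) (hb : ∀ i, 0 < b i)
    (hV : Fintype.card V = ∑ i, b i) :
    #(labelledPerms V b) * ∏ i, b i = (Fintype.card V)! := by
  have e : (Σ i, Fin (b i)) ≃ V := Fintype.equivOfCardEq (by simp [hV])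
  rw [← card_pointedPerms, ← Fintype.card_congr e, ← Fintype.card_equiv e, ← Finset.card_univ]
  symm
  refine Finset.card_bij (fun θ _ => pointedOfEquiv b hb θ) (fun θ _ => pointedOfEquiv_mem b hb θ)
    (fun θ _ η _ h => pointedOfEquiv_injective b hb h) fun p hp => ?_
  obtain ⟨θ, hθ⟩ := exists_pointedOfEquiv_eq b hb hp
  exact ⟨θ, Finset.mem_univ _, hθ⟩

lemma ncard_fiber {n : ℕ} (c : V → Fin n) (i : Fin n) :
    {x | c x = i}.ncard = fiberCard c i := by
  rw [fiberCard, ← Set.ncard_coe_finset]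
  congr 1
  ext x; simp

lemma sameCycle_inv_iff_full (π : Equiv.Perm V) :
    (∀ x y, π⁻¹.SameCycle x y) ↔ ∀ x y, π.SameCycle x y := by
  simp

/-- The relation determines `σ`, so the count reduces to `ρ` and the transpositions. All labels are
used because every `b i` is positive. -/
lemma isMonodromy_iff {n d m : ℕ} {b : Fin n → ℕ} (hb : ∀ i, 0 < b i)
    {σ : Equiv.Perm (Fin d)} {τ : Fin m → Equiv.Perm (Fin d)} {ρ : Equiv.Perm (Fin d)}
    {c : Fin d → Fin n} : IsMonodromy b σ τ ρ c ↔ (ρ, c) ∈ labelledPerms (Fin d) b ∧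
      ((∀ k, (τ k).IsSwap) ∧ ∀ x y, ((List.ofFn τ).prod * ρ).SameCycle x y) ∧
        σ = ((List.ofFn τ).prod * ρ)⁻¹ := by
  rw [mem_labelledPerms]
  constructor
  · intro h
    have hσ : σ = ((List.ofFn τ).prod * ρ)⁻¹ := by
      rw [eq_inv_iff_mul_eq_one, ← mul_assoc, h.prod_eq_one]
    refine ⟨⟨⟨h.label, fun i => ?_⟩, fun i => by rw [← h.length, ncard_fiber]⟩,
      ⟨h.simple, ?_⟩, hσ⟩
    · have h1 : fiberCard c i ≠ 0 := by
        rw [← ncard_fiber, h.length]; exact (hb i).ne'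
      obtain ⟨x, hx⟩ := Finset.card_ne_zero.1 h1
      exact ⟨x, (Finset.mem_filter.1 hx).2⟩
    · rw [← sameCycle_inv_iff_full, ← hσ]
      exact h.full_cycle
  · rintro ⟨⟨h1, h2⟩, ⟨h3, h4⟩, rfl⟩
    refine ⟨(sameCycle_inv_iff_full _).2 h4, h3, ?_, h1.eq_iff, fun i => ?_⟩
    · rw [mul_assoc, inv_mul_cancel]
    · rw [ncard_fiber]; exact h2 i

lemma ncard_isMonodromy {n d m : ℕ} (b : Fin n → ℕ) (hb : ∀ i, 0 < b i) :
    {x : Equiv.Perm (Fin d) × (Fin m → Equiv.Perm (Fin d)) × Equiv.Perm (Fin d) ×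
      (Fin d → Fin n) | IsMonodromy b x.1 x.2.1 x.2.2.1 x.2.2.2}.ncard =
        ∑ p ∈ labelledPerms (Fin d) b, facCount m p.1 := by
  classical
  have h1 : {x : Equiv.Perm (Fin d) × (Fin m → Equiv.Perm (Fin d)) × Equiv.Perm (Fin d) ×
      (Fin d → Fin n) | IsMonodromy b x.1 x.2.1 x.2.2.1 x.2.2.2} =
      (({x : Equiv.Perm (Fin d) × (Fin m → Equiv.Perm (Fin d)) × Equiv.Perm (Fin d) ×
        (Fin d → Fin n) | IsMonodromy b x.1 x.2.1 x.2.2.1 x.2.2.2} : Finset _) : Set _) := by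
    ext x; simp
  rw [h1, Set.ncard_coe_finset,
    Finset.card_eq_sum_card_fiberwise (f := fun x => x.2.2) (t := labelledPerms (Fin d) b)
      fun x hx => ((isMonodromy_iff hb).1 (Finset.mem_filter.1 hx).2).1]
  refine Finset.sum_congr rfl fun p hp => ?_
  rw [← card_factorizations]
  refine Finset.card_nbij' (fun x => x.2.1)
    (fun τ => (((List.ofFn τ).prod * p.1)⁻¹, τ, p)) ?_ ?_ ?_ ?_
  · rintro ⟨σ, τ, q⟩ hx
    obtain ⟨hx1, rfl⟩ := Finset.mem_filter.1 hx
    have hx' := (isMonodromy_iff hb).1 (Finset.mem_filter.1 hx1).2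
    exact mem_factorizations.2 hx'.2.1
  · intro τ hτ
    refine Finset.mem_filter.2 ⟨Finset.mem_filter.2 ⟨Finset.mem_univ _, ?_⟩, rfl⟩
    exact (isMonodromy_iff hb).2 ⟨hp, mem_factorizations.1 hτ, rfl⟩
  · rintro ⟨σ, τ, q⟩ hx
    obtain ⟨hx1, rfl⟩ := Finset.mem_filter.1 hx
    have hx' := (isMonodromy_iff hb).1 (Finset.mem_filter.1 hx1).2
    exact Prod.ext hx'.2.2.symm rfl
  · intro τ _
    rfl

/-- The formula of Goulden, Jackson and Vakil for one-part double Hurwitz numbers. -/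
theorem hurwitz_formula (g n : ℕ) (hn : 1 ≤ n) (hg : g = 0 → 3 ≤ n) (b : Fin n → ℕ)
    (hb : ∀ i, 1 ≤ b i) :
    hurwitz g b / ((degree b : ℚ) * ((numSimple g n)! : ℚ)) =
      (degree b : ℚ) ^ (2 * g + n - 3) * PowerSeries.coeff (2 * g) (hurwitzSeries b) := by
  have hd : 0 < degree b :=
    lt_of_lt_of_le (hb ⟨0, hn⟩) (Finset.single_le_sum (f := b) (fun _ _ => Nat.zero_le _)
      (Finset.mem_univ (⟨0, hn⟩ : Fin n)))
  have : Nonempty (Fin (degree b)) := ⟨⟨0, hd⟩⟩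
  have hL := card_labelledPerms_mul_prod (V := Fin (degree b)) b hb (Fintype.card_fin _)
  have hcount : ((∑ p ∈ labelledPerms (Fin (degree b)) b, facCount (numSimple g n) p.1 : ℕ) : ℚ) =
      #(labelledPerms (Fin (degree b)) b) * ((numSimple g n)! *
        PowerSeries.coeff (numSimple g n) (countSeries (degree b) b)) := by
    rw [Nat.cast_sum, Finset.sum_congr rfl fun p hp => ?_, Finset.sum_const, nsmul_eq_mul]
    have hp' := mem_labelledPerms.1 hp
    rw [facCount_eq _ hp'.1, funext hp'.2, Fintype.card_fin]
  have hcoeff : PowerSeries.coeff (numSimple g n) (countSeries (degree b) b) =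
      (∏ i, (b i : ℚ)) / degree b * ((degree b : ℚ) ^ (2 * g + n - 1) *
        PowerSeries.coeff (2 * g) (hurwitzSeries b)) := by
    have h1 : numSimple g n = 2 * g + (n - 1) := by rw [numSimple]; omega
    rw [h1, countSeries, PowerSeries.coeff_C_mul, Fintype.card_fin, mul_pow, ← map_pow, mul_assoc,
      PowerSeries.coeff_C_mul, PowerSeries.coeff_X_pow_mul, PowerSeries.coeff_rescale,
      show 2 * g + n - 1 = n - 1 + 2 * g by omega, pow_add]
    ring
  rw [Fintype.card_fin] at hL
  have hL' : (#(labelledPerms (Fin (degree b)) b) : ℚ) * ∏ i, (b i : ℚ) = (degree b)! := by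
    exact_mod_cast hL
  rw [hurwitz, ncard_isMonodromy b hb, hcount, hcoeff,
    -- Two powers of the degree are absorbed: one by the prefactor `1/d` of `countSeries`, one by
    -- the division by `d` on the left. The exclusion of `(0,1)` and `(0,2)` keeps `2g + n - 3` from
    -- being truncated.
    show 2 * g + n - 1 = 2 * g + n - 3 + 2 by omega, pow_add, ← hL']
  have h2 : (#(labelledPerms (Fin (degree b)) b) : ℚ) * ∏ i, (b i : ℚ) ≠ 0 := by
    rw [hL']; positivity
  have h3 := left_ne_zero_of_mul h2
  have h4 := right_ne_zero_of_mul h2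
  have h5 : (degree b : ℚ) ≠ 0 := by positivity
  have h6 : ((numSimple g n)! : ℚ) ≠ 0 := by positivity
  field_simp

theorem isGJVSystem_gjv : IsGJVSystem gjv where
  dimension j k h := if_neg h
  formula g n hn hg b hb := by
    rw [hurwitz_formula g n hn hg b hb, gjv_formula g n hn hg b]

theorem bracket_eq_gjv : bracket = gjv :=
  (Classical.epsilon_spec ⟨gjv, isGJVSystem_gjv⟩ : IsGJVSystem bracket).unique isGJVSystem_gjv

end

end GJV

end

theorem mainTheorem3 :
    (∃! N : ℕ → (ℕ →₀ ℕ) → ℚ, GJV.IsGJVSystem N) ∧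
    GJV.FormallySummable (GJV.expTerm GJV.M2 (GJV.q 1)) ∧
    GJV.del 1 GJV.F = GJV.Lambda1 GJV.F + (1 / 2 : ℚ) • (GJV.q 1) ^ 2 ∧
    GJV.del 1 (GJV.del 1 GJV.F) = GJV.expOp GJV.M2 (GJV.q 1) :=
  ⟨⟨GJV.gjv, GJV.isGJVSystem_gjv, fun _ hN => hN.unique GJV.isGJVSystem_gjv⟩,
    GJV.summable_expTerm_M2_q_one, GJV.string_equation GJV.bracket_eq_gjv,
    GJV.del_del_F GJV.bracket_eq_gjv⟩
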